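/- **Proposition 4.2 (with Proposition 4.1 and the resulting norm compatible sequences).** Let $p$ be a prime, $K$ a finite extension of $\mathbb{Q}_p$ with ring of integers $\mathcal{O}_K$, $\pi$ a uniformizer of $\mathcal{O}_K$ and $q=\#(\mathcal{O}_K/\pi\mathcal{O}_K)$. Let $\Omega$ be an algebraic closure of $K$, with the absolute value extending that of $K$. Let $f\in\mathcal{O}_K[[x]]$ satisfy $f(x)\equiv \pi x \bmod \deg 2$ and $f(x)\equiv x^q \bmod \pi$, and let $R(\pi,q)$ be the set of monic polynomials $g\in\mathcal{O}_K[x]$ of degree $q$ with $g(x)\equiv \pi x\bmod \deg 2$ and $g(x)\equiv x^q\bmod \pi$. Take $g\in R(\pi,q)$. There is exactly one commutative formal group law $F_f$ over $\mathcal{O}_K$ having $f$ as an endomorphism, exactly one, $F_g$, having $g$ as an endomorphism, and exactly one isomorphism $r=i_{f,g}\colon F_f\to F_g$ of formal group laws over $\mathcal{O}_K$ with $r(x)\equiv x\bmod\deg 2$. Write $x\oplus_f y=F_f(x,y)$ and $x\oplus_g y=F_g(x,y)$. For $n\ge 0$ let $\mathfrak{F}_n$ be the set of zeros in the open unit disc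 of $\Omega$ of the $(n+1)$-fold iterate of $f$, let $\mathfrak{G}_0$ be the set of zeros of $g$ there, and let $K_n=K(\mathfrak{F}_n)$. The sets $\mathfrak{F}_0$ and $\mathfrak{G}_0$ are finite, and the following hold (in 1 and 2 as identities of power series in $x$ with coefficients in $\Omega$, where a series is substituted into another by coefficientwise convergence). 1. For every $s\in\mathcal{O}_K[[x]]$ with $s(0)=0$, $$\prod_{z\in\mathfrak{G}_0}\bigl(s(x)\oplus_g z\bigr)=(-1)^{p-1}g(s(x)).$$ 2. $$\prod_{v\in\mathfrak{F}_0} r(x\oplus_f v)=(-1)^{p-1}r(f(x)).$$ 3. Let $(v_n)_{n\ge 0}$ be a sequence with $v_n\in\mathfrak{F}_n$, $v_0\ne 0$ and $f(v_{n+1})=v_n$ for all $n\ge 0$, and put $a_n=(-1)^{p-1}r(v_n)$. Then $(a_n)$ is a norm compatible sequence in the tower $(K_n)$: for every $n\ge 0$, $K_n\subseteq K_{n+1}$, the extension $K_{n+1}/K_n$ is finite, $a_n\in K_n$, and $N_{K_{n+1}/K_n}(a_{n+1})=a_n$. -/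

import Mathlib

open scoped PowerSeries PowerSeries.WithPiTopology

noncomputable section

namespace LubinTate

section Formal

variable {R : Type*} [CommRing R]

/-- The power series `f ∈ R⟦x⟧` with `f ≡ π x mod deg 2` and `f ≡ x ^ q mod π`. -/
def IsFrobeniusSeries (π : R) (q : ℕ) (f : R⟦X⟧) : Prop :=
  (PowerSeries.X ^ 2 ∣ f - PowerSeries.C π * PowerSeries.X) ∧
    (PowerSeries.C π ∣ f - PowerSeries.X ^ q)

/-- The set `R(π, q)` of monic polynomials `g` of degree `q` with
`g ≡ π x mod deg 2` and `g ≡ x ^ q mod π`. -/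
def polySet (π : R) (q : ℕ) : Set (Polynomial R) :=
  {g | g.Monic ∧ g.natDegree = q ∧ IsFrobeniusSeries π q (g : R⟦X⟧)}

/-- `h` is a homomorphism of formal group laws `F → G`: `h(0) = 0` and
`h(F(X, Y)) = G(h(X), h(Y))`. -/
def IsFormalHom (F G : FormalGroup R) (h : R⟦X⟧) : Prop :=
  PowerSeries.constantCoeff h = 0 ∧
    PowerSeries.subst F.toPowerSeries h =
      MvPowerSeries.subst
        ![PowerSeries.subst (MvPowerSeries.X 0 : MvPowerSeries (Fin 2) R) h,
          PowerSeries.subst (MvPowerSeries.X 1 : MvPowerSeries (Fin 2) R) h] G.toPowerSeries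

/-- `h` is an isomorphism of formal group laws `F → G`: a homomorphism that has an inverse
homomorphism with respect to composition. -/
def IsFormalIso (F G : FormalGroup R) (h : R⟦X⟧) : Prop :=
  IsFormalHom F G h ∧ ∃ k : R⟦X⟧, IsFormalHom G F k ∧
    PowerSeries.subst h k = PowerSeries.X ∧ PowerSeries.subst k h = PowerSeries.X

/-- `F` is a commutative formal group law that has `f` as an endomorphism. -/
def IsLubinTateLaw (f : R⟦X⟧) (F : FormalGroup R) : Prop :=
  F.IsComm ∧ IsFormalHom F F f

/-- `h` is an isomorphism `F → G` with `h ≡ x mod deg 2`. -/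
def IsTangentIso (F G : FormalGroup R) (h : R⟦X⟧) : Prop :=
  IsFormalIso F G h ∧ PowerSeries.X ^ 2 ∣ h - PowerSeries.X

instance : Nonempty (FormalGroup R) := ⟨FormalGroup.𝔾ₐ⟩

/-- The Lubin-Tate formal group law `F_f`: the commutative formal group law with `f` as an
endomorphism (meaningful for those `f` for which there is exactly one). -/
def groupLaw (f : R⟦X⟧) : FormalGroup R :=
  Classical.epsilon (IsLubinTateLaw f)

/-- The series `i_{f,g}`: the isomorphism `F_f → F_g` tangent to the identity (meaningful for
those `f`, `g` for which there is exactly one). -/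
def tangentIso (f g : R⟦X⟧) : R⟦X⟧ :=
  Classical.epsilon (IsTangentIso (groupLaw f) (groupLaw g))

end Formal

section Local

variable (K : Type*) [NormedField K] [IsUltrametricDist K]

/-- The ring of integers `{x : ‖x‖ ≤ 1}` of a nonarchimedean normed field. -/
abbrev integers : ValuationSubring K := (NormedField.valuation (K := K)).valuationSubring

variable {K}

section Eval

variable {A : Type*} [CommRing A] [Algebra K A] [TopologicalSpace A]

/-- The value `h(a) = ∑ cₙ aⁿ` of a power series with integral coefficients, as a convergent sum
in a topological `K`-algebra. It is used for points of the open unit disc of an extension field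
`Ω` of `K`, and for elements of `Ω⟦X⟧` (with the topology of coefficientwise convergence) whose
constant coefficient lies in the open unit disc. -/
def evalSeries (h : (integers K)⟦X⟧) (a : A) : A :=
  ∑' n : ℕ, algebraMap K A (algebraMap (integers K) K (PowerSeries.coeff n h)) * a ^ n

/-- The value `F(a, b) = ∑ cᵢⱼ aⁱ bʲ`, as a convergent sum. -/
def evalLaw (F : FormalGroup (integers K)) (a b : A) : A :=
  ∑' m : Fin 2 →₀ ℕ,
    algebraMap K A (algebraMap (integers K) K (MvPowerSeries.coeff m F.toPowerSeries)) *
      (a ^ m 0 * b ^ m 1)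

end Eval

variable (Ω : Type*) [NormedField Ω] [NormedAlgebra K Ω]

/-- A power series with integral coefficients regarded as a power series over `Ω`. -/
def toSeries (h : (integers K)⟦X⟧) : Ω⟦X⟧ :=
  PowerSeries.map ((algebraMap K Ω).comp (algebraMap (integers K) K)) h

/-- The torsion points of level `n`: the zeros in the open unit disc of `Ω` of the `(n + 1)`-fold
iterate of `f` (for `f` with `f(0) = 0`, which maps that disc to itself). -/
def torsion (f : (integers K)⟦X⟧) (n : ℕ) : Set Ω :=
  {x | ‖x‖ < 1 ∧ (evalSeries f : Ω → Ω)^[n + 1] x = 0}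

/-- The field `K_n` generated over `K` by the torsion points of level `n`. -/
def torsionField (f : (integers K)⟦X⟧) (n : ℕ) : IntermediateField K Ω :=
  IntermediateField.adjoin K (torsion Ω f n)

end Local

/-- `(aₙ)` is a norm compatible sequence in the tower of fields `E₀ ⊆ E₁ ⊆ ⋯`:
`aₙ ∈ Eₙ`, each step `Eₙ₊₁ / Eₙ` is a finite extension, and its norm map sends
`aₙ₊₁` to `aₙ`. -/
def IsNormCompatible {K Ω : Type*} [Field K] [Field Ω] [Algebra K Ω]
    (E : ℕ → IntermediateField K Ω) (a : ℕ → Ω) : Prop :=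
  ∀ n, ∃ (hE : E n ≤ E (n + 1)) (h₀ : a n ∈ E n) (h₁ : a (n + 1) ∈ E (n + 1)),
    FiniteDimensional (E n) (IntermediateField.extendScalars hE) ∧
      Algebra.norm (E n) (⟨a (n + 1), h₁⟩ : IntermediateField.extendScalars hE) = ⟨a n, h₀⟩

end LubinTate

end

/-!
The construction rests on the Lubin-Tate lemma `exists_intertwines`. If `f` and `g` are both
`π x + ⋯` and congruent to `x ^ q` modulo `π`, then every linear form `L` extends uniquely to a
series `F` with `g(F(X)) = F(f(X₁), f(X₂), …)`: changing `F` in degree `m` changes the defect of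
this equation in degree `m` by the factor `π - π ^ m`, which is `π` times a unit, and the defect
is divisible by `π` since `F ^ q ≡ F(X₁ ^ q, …)` modulo `π`. For `L = X + Y` this gives the formal
group law, for `L = a X` the series `[a]`, and for `a = 1` the isomorphism `r`; all identities
between these series follow from uniqueness. Homomorphisms are determined by their linear
coefficients because they commute with `[2](x) = F(x, x)`.

Series are evaluated in rings that are complete for a linear topology: the unit ball of a finite
extension `L` of `K` in `Ω`, and the power series ring over it. Since the topologies of `Ω` and of
`Ω⟦X⟧` restrict to these, the values agree with the convergent sums over `Ω` and over `Ω⟦X⟧`, and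
substitution of series becomes composition of their values.

The product formulas come from a factorization (`map_sub_C_eq_prod`). For a series `s` without
constant term, the monic polynomial `g(Y) - g(s)` of degree `q` has the `q` distinct zeros
`s ⊕ z`, where `z` runs through the zeros of `g`, because `g(s ⊕ z) = g(s) ⊕ g(z) = g(s)` and the
constant term of `s ⊕ z` is `z`. At `Y = 0` this is the first formula. In the second,
`r(x ⊕ v) = r(x) ⊕ r(v)`, and `r` maps the zeros of `f` bijectively to those of `g`, so it is the
first formula for `s = r`.

For the norms put `wₙ = r(vₙ)`, so that `w₀ ≠ 0` is a zero of `g` and `g(wₙ₊₁) = wₙ`. Comparing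
norms of terms yields `‖wₙ‖ ^ ((q - 1) q ^ n) = ‖π‖`, hence `[K(wₙ) : K] ≥ (q - 1) q ^ n`, as the
norm on `K` takes only powers of `‖π‖` as nonzero values. The zeros of `g(x) / x` and of
`g(x) - wₙ` give the opposite inequality, so `g(x) - wₙ` is the minimal polynomial of `wₙ₊₁` over
`K(wₙ)` (`IsDivisionSequence.norm_gen`), and the norm of `wₙ₊₁` is read off from its constant
term. Finally `Kₙ = K(wₙ)` (`IsDivisionSequence.torsionField_eq_adjoin`): every torsion point of
`g` of level `n` is the value at `wₙ` of a series with coefficients in `K`, by induction on `n`,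
as the solutions of `g(y) = g(t)` are the points `t ⊕ z` and every zero `z` of `g` is some
`[a](w₀)`.
-/

noncomputable section

namespace LubinTate

/-! ### Series intertwining two Frobenius series -/

section Intertwining

variable {R : Type*} [CommRing R] {σ τ : Type*}

/-- `F` intertwines the series `f` and `g` in one variable: `g(F(X)) = F(f(X₁), f(X₂), …)`. -/
def Intertwines (f g : R⟦X⟧) (F : MvPowerSeries σ R) : Prop :=
  PowerSeries.subst F g =
    MvPowerSeries.subst (fun i => PowerSeries.subst (MvPowerSeries.X i : MvPowerSeries σ R) f) F

lemma constantCoeff_subst_X (i : σ) {f : R⟦X⟧} (hf : PowerSeries.constantCoeff f = 0) :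
    MvPowerSeries.constantCoeff (PowerSeries.subst (MvPowerSeries.X i : MvPowerSeries σ R) f) =
      0 :=
  PowerSeries.constantCoeff_subst_eq_zero (MvPowerSeries.constantCoeff_X i) f hf

lemma hasSubst_subst_X [Finite σ] {f : R⟦X⟧} (hf : PowerSeries.constantCoeff f = 0) :
    MvPowerSeries.HasSubst
      (fun i => PowerSeries.subst (MvPowerSeries.X i : MvPowerSeries σ R) f) :=
  MvPowerSeries.hasSubst_of_constantCoeff_zero fun i => constantCoeff_subst_X i hf

/-- Two series without constant term that agree below degree `m` have `k`-th powers, `k ≥ 2`,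
that agree up to degree `m`. -/
lemma coeff_pow_eq_of_forall_lt {F G : MvPowerSeries σ R}
    (hF : MvPowerSeries.constantCoeff F = 0) (hG : MvPowerSeries.constantCoeff G = 0) {m : ℕ}
    (h : ∀ d : σ →₀ ℕ, d.degree < m → MvPowerSeries.coeff d F = MvPowerSeries.coeff d G)
    {k : ℕ} (hk : 2 ≤ k) {d : σ →₀ ℕ} (hd : d.degree ≤ m) :
    MvPowerSeries.coeff d (F ^ k) = MvPowerSeries.coeff d (G ^ k) := by
  rw [← sub_eq_zero, ← map_sub, ← geom_sum₂_mul]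
  apply MvPowerSeries.coeff_of_lt_order
  have h1 : (m : ℕ∞) ≤ (F - G).order :=
    MvPowerSeries.nat_le_order fun e he => by rw [map_sub, h e he, sub_self]
  have h2 : 1 ≤ (∑ i ∈ Finset.range k, F ^ i * G ^ (k - 1 - i)).order := by
    rw [MvPowerSeries.one_le_order_iff_constCoeff_eq_zero, map_sum]
    refine Finset.sum_eq_zero fun i _ => ?_
    rcases Nat.eq_zero_or_pos i with rfl | hi
    · rw [map_mul, map_pow, map_pow, hG, zero_pow (by omega), mul_zero]
    · rw [map_mul, map_pow, hF, zero_pow hi.ne', zero_mul]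
  calc (d.degree : ℕ∞) < 1 + m := by exact_mod_cast (by omega : d.degree < 1 + m)
    _ ≤ _ := add_le_add h2 h1
    _ ≤ _ := MvPowerSeries.le_order_mul

/-- If `F` and `G` agree below degree `m`, then in degree `m` the series `g(F)` and `g(G)` differ
by the linear coefficient of `g` times the difference of `F` and `G`. -/
lemma coeff_subst_sub_coeff_subst {F G : MvPowerSeries σ R}
    (hF : MvPowerSeries.constantCoeff F = 0) (hG : MvPowerSeries.constantCoeff G = 0)
    {d : σ →₀ ℕ}
    (h : ∀ e : σ →₀ ℕ, e.degree < d.degree →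
      MvPowerSeries.coeff e F = MvPowerSeries.coeff e G) (g : R⟦X⟧) :
    MvPowerSeries.coeff d (PowerSeries.subst F g) - MvPowerSeries.coeff d (PowerSeries.subst G g) =
      PowerSeries.coeff 1 g * (MvPowerSeries.coeff d F - MvPowerSeries.coeff d G) := by
  have hF' := PowerSeries.HasSubst.of_constantCoeff_zero hF
  have hG' := PowerSeries.HasSubst.of_constantCoeff_zero hG
  rw [PowerSeries.coeff_subst hF', PowerSeries.coeff_subst hG',
    ← finsum_sub_distrib (PowerSeries.coeff_subst_finite hF' g d)
      (PowerSeries.coeff_subst_finite hG' g d), finsum_eq_single _ 1]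
  · simp [mul_sub]
  · intro k hk
    rcases Nat.eq_zero_or_pos k with rfl | hk0
    · simp
    · rw [coeff_pow_eq_of_forall_lt hF hG h (by omega) le_rfl, sub_self]

/-- If `D` has no terms of degree less than that of `d`, then the coefficient at `d` of
`D(f(X₁), f(X₂), …)` is that of `D` times a power of the linear coefficient of `f`. -/
lemma coeff_subst_subst_X [Finite σ] {D : MvPowerSeries σ R} {d : σ →₀ ℕ}
    (h : ∀ e : σ →₀ ℕ, e.degree < d.degree → MvPowerSeries.coeff e D = 0) {f : R⟦X⟧}
    (hf : PowerSeries.constantCoeff f = 0) :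
    MvPowerSeries.coeff d (MvPowerSeries.subst
      (fun i => PowerSeries.subst (MvPowerSeries.X i : MvPowerSeries σ R) f) D) =
      PowerSeries.coeff 1 f ^ d.degree * MvPowerSeries.coeff d D := by
  classical
  obtain ⟨u, rfl⟩ := PowerSeries.X_dvd_iff.mpr hf
  -- for `f = x u(x)` the monomial `X ^ e` becomes `X ^ e` times a series with constant term a power
  -- of `u(0)`
  have key : ∀ e : σ →₀ ℕ, (e.prod fun i k =>
      PowerSeries.subst (MvPowerSeries.X i : MvPowerSeries σ R) (PowerSeries.X * u) ^ k) =
      MvPowerSeries.monomial e 1 * e.prod fun i k =>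
        PowerSeries.subst (MvPowerSeries.X i : MvPowerSeries σ R) u ^ k := by
    intro e
    rw [MvPowerSeries.monomial_eq', map_one, one_mul, ← Finsupp.prod_mul]
    refine Finsupp.prod_congr fun i _ => ?_
    rw [PowerSeries.subst_mul (PowerSeries.HasSubst.X i),
      PowerSeries.subst_X (PowerSeries.HasSubst.X i), mul_pow]
  have hu : ∀ i : σ, MvPowerSeries.constantCoeff
      (PowerSeries.subst (MvPowerSeries.X i : MvPowerSeries σ R) u) =
      PowerSeries.constantCoeff u := by
    intro i
    rw [← MvPowerSeries.coeff_zero_eq_constantCoeff_apply, PowerSeries.coeff_subst_single]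
    simp
  rw [MvPowerSeries.coeff_subst (hasSubst_subst_X hf), finsum_eq_single _ d]
  · rw [key, MvPowerSeries.coeff_monomial_mul, if_pos le_rfl, tsub_self,
      MvPowerSeries.coeff_zero_eq_constantCoeff_apply, Finsupp.prod, map_prod, one_mul,
      smul_eq_mul, mul_comm]
    simp_rw [map_pow, hu]
    rw [Finset.prod_pow_eq_pow_sum, Finsupp.degree_apply, show (1 : ℕ) = 0 + 1 from rfl,
      PowerSeries.coeff_succ_X_mul, PowerSeries.coeff_zero_eq_constantCoeff_apply]
  · intro e he
    by_cases hlt : e.degree < d.degree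
    · rw [h e hlt, zero_smul]
    · rw [key, MvPowerSeries.coeff_monomial_mul, if_neg, smul_zero]
      intro hle
      apply hlt
      obtain ⟨c, rfl⟩ := le_iff_exists_add.mp hle
      rw [map_add]
      have : c.degree ≠ 0 := by
        rw [Ne, Finsupp.degree_eq_zero_iff]
        rintro rfl
        exact he (add_zero e).symm
      omega

/-- The defect of `F` from intertwining `f` and `g`. -/
def defect (f g : R⟦X⟧) (F : MvPowerSeries σ R) : MvPowerSeries σ R :=
  PowerSeries.subst F g -
    MvPowerSeries.subst (fun i => PowerSeries.subst (MvPowerSeries.X i : MvPowerSeries σ R) f) F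

lemma intertwines_iff_defect {f g : R⟦X⟧} {F : MvPowerSeries σ R} :
    Intertwines f g F ↔ defect f g F = 0 := sub_eq_zero.symm

/-- Changing `F` in degree `m` changes its defect in degree `m` by a multiple `a - a ^ m` of the
change, where `a` is the common linear coefficient of `f` and `g`. -/
lemma coeff_defect_sub [Finite σ] {f g : R⟦X⟧} (hf : PowerSeries.constantCoeff f = 0)
    (hfg : PowerSeries.coeff 1 f = PowerSeries.coeff 1 g) {F G : MvPowerSeries σ R}
    (hF : MvPowerSeries.constantCoeff F = 0) (hG : MvPowerSeries.constantCoeff G = 0)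
    {d : σ →₀ ℕ}
    (h : ∀ e : σ →₀ ℕ, e.degree < d.degree →
      MvPowerSeries.coeff e F = MvPowerSeries.coeff e G) :
    MvPowerSeries.coeff d (defect f g F) - MvPowerSeries.coeff d (defect f g G) =
      (PowerSeries.coeff 1 f - PowerSeries.coeff 1 f ^ d.degree) *
        (MvPowerSeries.coeff d F - MvPowerSeries.coeff d G) := by
  have h1 := coeff_subst_sub_coeff_subst hF hG h g
  have h2 := coeff_subst_subst_X (D := F - G) (d := d)
    (fun e he => by rw [map_sub, h e he, sub_self]) hf
  rw [MvPowerSeries.subst_sub (hasSubst_subst_X hf), map_sub, map_sub] at h2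
  rw [defect, defect, map_sub, map_sub, sub_sub_sub_comm, h1, h2, hfg]
  ring

/-- A series intertwining `f` and `g` is determined by its linear part. -/
theorem Intertwines.ext [Finite σ] [IsDomain R] {f g : R⟦X⟧}
    (hf : PowerSeries.constantCoeff f = 0)
    (hfg : PowerSeries.coeff 1 f = PowerSeries.coeff 1 g)
    (ha : ∀ m, 2 ≤ m → PowerSeries.coeff 1 f ^ m ≠ PowerSeries.coeff 1 f)
    {F G : MvPowerSeries σ R} (hFi : Intertwines f g F) (hGi : Intertwines f g G)
    (hF : MvPowerSeries.constantCoeff F = 0) (hG : MvPowerSeries.constantCoeff G = 0)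
    (h : ∀ i, MvPowerSeries.coeff (Finsupp.single i 1) F =
      MvPowerSeries.coeff (Finsupp.single i 1) G) : F = G := by
  have key : ∀ m, ∀ d : σ →₀ ℕ, d.degree = m →
      MvPowerSeries.coeff d F = MvPowerSeries.coeff d G := by
    intro m
    induction m using Nat.strong_induction_on with
    | _ m ih =>
      intro d hd
      rcases Nat.lt_or_ge m 2 with hm | hm
      · interval_cases m
        · rw [Finsupp.degree_eq_zero_iff] at hd
          rw [hd, MvPowerSeries.coeff_zero_eq_constantCoeff_apply,
            MvPowerSeries.coeff_zero_eq_constantCoeff_apply, hF, hG]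
        · obtain ⟨i, rfl⟩ := (Finsupp.sum_eq_one_iff d).mp hd
          exact h i
      · have := coeff_defect_sub hf hfg hF hG (d := d) fun e he => ih _ (hd ▸ he) e rfl
        rw [intertwines_iff_defect.mp hFi, intertwines_iff_defect.mp hGi, sub_self, eq_comm,
          mul_eq_zero] at this
        rcases this with h0 | h0
        · exact absurd (sub_eq_zero.mp h0).symm (ha _ (hd ▸ hm))
        · exact sub_eq_zero.mp h0
  exact MvPowerSeries.ext fun d => key _ d rfl

lemma intertwines_X [Finite σ] {f : R⟦X⟧} (hf : PowerSeries.constantCoeff f = 0) (i : σ) :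
    Intertwines f f (MvPowerSeries.X i) := by
  rw [Intertwines, MvPowerSeries.subst_X (hasSubst_subst_X hf)]

lemma Intertwines.comp [Finite σ] [Finite τ] {e f g : R⟦X⟧}
    (he : PowerSeries.constantCoeff e = 0) (hf : PowerSeries.constantCoeff f = 0)
    {F : MvPowerSeries σ R} (hF : MvPowerSeries.constantCoeff F = 0) (hFi : Intertwines f g F)
    {G : σ → MvPowerSeries τ R} (hG : ∀ i, MvPowerSeries.constantCoeff (G i) = 0)
    (hGi : ∀ i, Intertwines e f (G i)) : Intertwines e g (MvPowerSeries.subst G F) := by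
  have hG' := MvPowerSeries.hasSubst_of_constantCoeff_zero hG
  have he' := hasSubst_subst_X (σ := τ) he
  unfold Intertwines
  rw [MvPowerSeries.subst_comp_subst_apply hG' he']
  have h1 : PowerSeries.subst (MvPowerSeries.subst G F) g =
      MvPowerSeries.subst G (PowerSeries.subst F g) := by
    rw [PowerSeries.subst, PowerSeries.subst, MvPowerSeries.subst_comp_subst_apply
      (PowerSeries.HasSubst.of_constantCoeff_zero hF).const hG']
  rw [h1, hFi, MvPowerSeries.subst_comp_subst_apply (hasSubst_subst_X hf) hG']
  congr 1
  funext i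
  rw [← hGi i, PowerSeries.subst, PowerSeries.subst, MvPowerSeries.subst_comp_subst_apply
      (PowerSeries.HasSubst.X i).const hG']
  simp only [MvPowerSeries.subst_X hG']

/-- The properties of a uniformizer `π` of a local ring with residue field of `q` elements on which
the Lubin-Tate construction depends. -/
structure IsFrobeniusBase (π : R) (q : ℕ) : Prop where
  ne_zero : π ≠ 0
  isUnit_one_sub_pow : ∀ m, m ≠ 0 → IsUnit (1 - π ^ m)
  one_lt : 1 < q
  exists_prime_pow : ∃ p r, p.Prime ∧ CharP (R ⧸ Ideal.span {π}) p ∧ q = p ^ r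
  pow_eq_self : ∀ x : R ⧸ Ideal.span {π}, x ^ q = x

lemma IsFrobeniusBase.pow_ne [IsDomain R] {π : R} {q : ℕ} (h : IsFrobeniusBase π q) (m : ℕ)
    (hm : 2 ≤ m) : π ^ m ≠ π := by
  obtain ⟨k, rfl⟩ := Nat.exists_eq_add_of_le hm
  intro he
  have hu := h.isUnit_one_sub_pow (k + 1) (by omega)
  have : π * (1 - π ^ (k + 1)) = 0 := by
    rw [mul_sub, mul_one, ← pow_succ', sub_eq_zero, show k + 1 + 1 = 2 + k by omega, he]
  rcases mul_eq_zero.mp this with h0 | h0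
  · exact h.ne_zero h0
  · exact hu.ne_zero h0

lemma IsFrobeniusSeries.coeff_one {π : R} {q : ℕ} {f : R⟦X⟧} (hf : IsFrobeniusSeries π q f) :
    PowerSeries.coeff 1 f = π := by
  have := PowerSeries.X_pow_dvd_iff.mp hf.1 1 (by norm_num)
  rwa [map_sub, PowerSeries.coeff_C_mul, PowerSeries.coeff_one_X, mul_one, sub_eq_zero] at this

lemma IsFrobeniusSeries.constantCoeff_eq {π : R} {q : ℕ} {f : R⟦X⟧}
    (hf : IsFrobeniusSeries π q f) : PowerSeries.constantCoeff f = 0 := by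
  have := PowerSeries.X_pow_dvd_iff.mp hf.1 0 (by norm_num)
  simpa using this

lemma IsFrobeniusSeries.map_mk {π : R} {q : ℕ} {f : R⟦X⟧} (hf : IsFrobeniusSeries π q f) :
    PowerSeries.map (Ideal.Quotient.mk (Ideal.span {π})) f = PowerSeries.X ^ q := by
  obtain ⟨h, hh⟩ := hf.2
  have : Ideal.Quotient.mk (Ideal.span {π}) π = 0 :=
    Ideal.Quotient.eq_zero_iff_mem.mpr (Ideal.mem_span_singleton_self π)
  rw [← sub_add_cancel f (PowerSeries.X ^ q), hh, map_add, map_mul, PowerSeries.map_C, this,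
    map_zero, zero_mul, zero_add, map_pow, PowerSeries.map_X]

/-- Modulo `π` both `g(F)` and `F(f(X₁), …)` are `F ^ q = F(X₁ ^ q, …)`. -/
lemma dvd_coeff_defect [Finite σ] {π : R} {q : ℕ} (h : IsFrobeniusBase π q) {f g : R⟦X⟧}
    (hf : IsFrobeniusSeries π q f) (hg : IsFrobeniusSeries π q g) {F : MvPowerSeries σ R}
    (hF : MvPowerSeries.constantCoeff F = 0) (d : σ →₀ ℕ) :
    π ∣ MvPowerSeries.coeff d (defect f g F) := by
  obtain ⟨p, r, hp, hchar, rfl⟩ := h.exists_prime_pow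
  have : Fact p.Prime := ⟨hp⟩
  set φ := Ideal.Quotient.mk (Ideal.span {π})
  have hF' := PowerSeries.HasSubst.of_constantCoeff_zero hF
  have hmF' : PowerSeries.HasSubst (MvPowerSeries.map φ F) :=
    PowerSeries.HasSubst.of_constantCoeff_zero (by
      rw [MvPowerSeries.constantCoeff_map, hF, map_zero])
  have hid : iterateFrobenius (R ⧸ Ideal.span {π}) p r = RingHom.id _ :=
    RingHom.ext fun x => h.pow_eq_self x
  have hzero : MvPowerSeries.map φ (defect f g F) = 0 := by
    rw [defect, map_sub, PowerSeries.map_subst hF', hg.map_mk,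
      MvPowerSeries.map_subst (hasSubst_subst_X hf.constantCoeff_eq), sub_eq_zero]
    have h2 : ∀ i : σ, MvPowerSeries.map φ
        (PowerSeries.subst (MvPowerSeries.X i : MvPowerSeries σ R) f) =
          MvPowerSeries.X i ^ p ^ r := fun i => by
      rw [PowerSeries.map_subst (PowerSeries.HasSubst.X i), hf.map_mk, MvPowerSeries.map_X,
        PowerSeries.subst_pow (PowerSeries.HasSubst.X i),
        PowerSeries.subst_X (PowerSeries.HasSubst.X i)]
    simp_rw [h2]
    rw [PowerSeries.subst_pow hmF', PowerSeries.subst_X hmF',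
      ← MvPowerSeries.map_iterateFrobenius_expand p hp.ne_zero, hid, MvPowerSeries.map_id,
      MvPowerSeries.expand, MvPowerSeries.substAlgHom_apply]
    rfl
  have := congrArg (MvPowerSeries.coeff d) hzero
  rw [MvPowerSeries.coeff_map, map_zero, Ideal.Quotient.eq_zero_iff_mem,
    Ideal.mem_span_singleton] at this
  exact this

/-- One step of the construction of an intertwining series: the terms of degree `m` can be
changed so that the defect vanishes in degree `m`. -/
lemma exists_coeff_defect_eq_zero [Finite σ] {π : R} {q : ℕ} (h : IsFrobeniusBase π q) {f g : R⟦X⟧}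
    (hf : IsFrobeniusSeries π q f) (hg : IsFrobeniusSeries π q g) {m : ℕ} (hm : 2 ≤ m)
    {F : MvPowerSeries σ R} (hF : MvPowerSeries.constantCoeff F = 0)
    (hFd : ∀ d : σ →₀ ℕ, d.degree < m → MvPowerSeries.coeff d (defect f g F) = 0) :
    ∃ G : MvPowerSeries σ R, (MvPowerSeries.constantCoeff G = 0 ∧
      ∀ d : σ →₀ ℕ, d.degree < m + 1 → MvPowerSeries.coeff d (defect f g G) = 0) ∧
      ∀ d : σ →₀ ℕ, d.degree < m → MvPowerSeries.coeff d G = MvPowerSeries.coeff d F := by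
  classical
  have hunit := h.isUnit_one_sub_pow (m - 1) (by omega)
  have hex : ∀ d : σ →₀ ℕ, ∃ c, (π - π ^ m) * c = - MvPowerSeries.coeff d (defect f g F) := by
    intro d
    have : π - π ^ m = π * (1 - π ^ (m - 1)) := by
      rw [mul_sub, mul_one, ← pow_succ', Nat.sub_add_cancel (by omega)]
    obtain ⟨c, hc⟩ := hunit.mul_right_dvd.mpr (dvd_neg.mpr (dvd_coeff_defect h hf hg hF d))
    exact ⟨c, by rw [this, hc]⟩
  choose c hc using hex
  -- the correction `c d` solves `(π - π ^ m) c = -(defect)`, which is possible since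
  -- `1 - π ^ (m - 1)` is a unit
  let G : MvPowerSeries σ R := fun d =>
    MvPowerSeries.coeff d F + if d.degree = m then c d else 0
  have hG : ∀ d, MvPowerSeries.coeff d G =
      MvPowerSeries.coeff d F + if d.degree = m then c d else 0 := fun d => rfl
  have hlt : ∀ d : σ →₀ ℕ, d.degree < m → MvPowerSeries.coeff d G = MvPowerSeries.coeff d F :=
    fun d hd => by rw [hG, if_neg hd.ne, add_zero]
  have hG0 : MvPowerSeries.constantCoeff G = 0 := by
    rw [← MvPowerSeries.coeff_zero_eq_constantCoeff_apply, hlt 0 (by rw [map_zero]; omega),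
      MvPowerSeries.coeff_zero_eq_constantCoeff_apply, hF]
  refine ⟨G, ⟨hG0, fun d hd => ?_⟩, hlt⟩
  have := coeff_defect_sub hf.constantCoeff_eq (hf.coeff_one.trans hg.coeff_one.symm) hG0 hF
    (d := d) fun e he => hlt e (by omega)
  rw [hG, add_sub_cancel_left, hf.coeff_one] at this
  split_ifs at this with hdm
  · rw [hdm, hc] at this
    linear_combination this
  · rw [hFd d (by omega), sub_zero, mul_zero] at this
    exact this

/-- **Lubin-Tate lemma.** Every linear form extends to a series intertwining two given series
with linear term `π x` that are congruent to `x ^ q` modulo `π`. -/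
theorem exists_intertwines [Finite σ] {π : R} {q : ℕ} (h : IsFrobeniusBase π q) {f g : R⟦X⟧}
    (hf : IsFrobeniusSeries π q f) (hg : IsFrobeniusSeries π q g) {L : MvPowerSeries σ R}
    (hL : MvPowerSeries.constantCoeff L = 0) :
    ∃ F : MvPowerSeries σ R, Intertwines f g F ∧ MvPowerSeries.constantCoeff F = 0 ∧
      ∀ i, MvPowerSeries.coeff (Finsupp.single i 1) F =
        MvPowerSeries.coeff (Finsupp.single i 1) L := by
  have hlin := hf.coeff_one.trans hg.coeff_one.symm
  let P : ℕ → MvPowerSeries σ R → Prop := fun m F => MvPowerSeries.constantCoeff F = 0 ∧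
      ∀ d : σ →₀ ℕ, d.degree < m → MvPowerSeries.coeff d (defect f g F) = 0
  have h0 : P 2 L := by
    refine ⟨hL, fun d hd => ?_⟩
    have hz : MvPowerSeries.constantCoeff (0 : MvPowerSeries σ R) = 0 := map_zero _
    have hdz : defect f g (0 : MvPowerSeries σ R) = 0 := by
      rw [defect, PowerSeries.subst_zero_of_constantCoeff_zero hg.constantCoeff_eq,
        ← MvPowerSeries.coe_substAlgHom (hasSubst_subst_X hf.constantCoeff_eq), map_zero, sub_zero]
    have := coeff_defect_sub hf.constantCoeff_eq hlin hL hz (d := d) fun e he => by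
      have : e = 0 := (Finsupp.degree_eq_zero_iff e).mp (by omega)
      rw [this, MvPowerSeries.coeff_zero_eq_constantCoeff_apply, hL, map_zero]
    rw [hdz, map_zero, sub_zero, sub_zero] at this
    rw [this]
    interval_cases hdd : d.degree
    · rw [(Finsupp.degree_eq_zero_iff d).mp hdd, MvPowerSeries.coeff_zero_eq_constantCoeff_apply,
        hL, mul_zero]
    · rw [pow_one, sub_self, zero_mul]
  choose! next hnext hagree using fun (m : ℕ) (F : MvPowerSeries σ R) (hm : 2 ≤ m) (hF : P m F) =>
    exists_coeff_defect_eq_zero h hf hg hm hF.1 hF.2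
  -- successive approximations: `S n` has no defect below degree `n + 2`, and `S n`, `S (n + 1)`
  -- agree there, so that the coefficients become stationary
  let S : ℕ → MvPowerSeries σ R := fun n => Nat.rec L (fun n F => next (n + 2) F) n
  have hS : ∀ n, P (n + 2) (S n) := by
    intro n
    induction n with
    | zero => exact h0
    | succ n ih => exact hnext (n + 2) (S n) (by omega) ih
  have hstep : ∀ n (d : σ →₀ ℕ), d.degree < n + 2 →
      MvPowerSeries.coeff d (S (n + 1)) = MvPowerSeries.coeff d (S n) := fun n d hd =>
    hagree (n + 2) (S n) (by omega) (hS n) d hd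
  have hstable : ∀ n k (d : σ →₀ ℕ), d.degree < n + 2 →
      MvPowerSeries.coeff d (S (n + k)) = MvPowerSeries.coeff d (S n) := by
    intro n k d hd
    induction k with
    | zero => rfl
    | succ k ih => rw [← add_assoc, hstep _ _ (by omega), ih]
  let F : MvPowerSeries σ R := fun d => MvPowerSeries.coeff d (S d.degree)
  have hF : ∀ n (d : σ →₀ ℕ), d.degree ≤ n → MvPowerSeries.coeff d F =
      MvPowerSeries.coeff d (S n) := by
    intro n d hd
    obtain ⟨k, rfl⟩ := Nat.exists_eq_add_of_le hd
    exact (hstable d.degree k d (by omega)).symm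
  have hF0 : MvPowerSeries.constantCoeff F = 0 := by
    rw [← MvPowerSeries.coeff_zero_eq_constantCoeff_apply, hF 0 0 (by rw [map_zero]),
      MvPowerSeries.coeff_zero_eq_constantCoeff_apply, (hS 0).1]
  refine ⟨F, ?_, hF0, fun i => ?_⟩
  · rw [intertwines_iff_defect]
    ext d
    have := coeff_defect_sub hf.constantCoeff_eq hlin hF0 (hS d.degree).1 (d := d)
      fun e he => hF d.degree e he.le
    rwa [hF d.degree d le_rfl, sub_self, mul_zero, (hS d.degree).2 d (by omega), sub_zero] at this
  · rw [hF 1 _ (by rw [Finsupp.degree_single])]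
    exact hstep 0 _ (by rw [Finsupp.degree_single]; omega)

end Intertwining

/-! ### Formal group laws and their homomorphisms -/

section FormalGroups

variable {R : Type*} [CommRing R] {σ τ : Type*}

/-- The chain rule at the origin. -/
lemma coeff_single_subst [Fintype σ] [Finite τ] {F : MvPowerSeries σ R}
    (hF : MvPowerSeries.constantCoeff F = 0) {G : σ → MvPowerSeries τ R}
    (hG : ∀ s, MvPowerSeries.constantCoeff (G s) = 0) (i : τ) :
    MvPowerSeries.coeff (Finsupp.single i 1) (MvPowerSeries.subst G F) =
      ∑ s, MvPowerSeries.coeff (Finsupp.single s 1) F *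
        MvPowerSeries.coeff (Finsupp.single i 1) (G s) := by
  classical
  have hG' := MvPowerSeries.hasSubst_of_constantCoeff_zero hG
  set D : MvPowerSeries σ R :=
    F - ∑ s, MvPowerSeries.coeff (Finsupp.single s 1) F • MvPowerSeries.X s with hD
  have hord : (2 : ℕ) ≤ D.order := by
    refine MvPowerSeries.nat_le_order fun d hd => ?_
    interval_cases hdd : d.degree
    · rw [(Finsupp.degree_eq_zero_iff d).mp hdd, MvPowerSeries.coeff_zero_eq_constantCoeff_apply,
        hD, map_sub, hF, map_sum]
      simp
    · obtain ⟨j, rfl⟩ := (Finsupp.sum_eq_one_iff d).mp hdd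
      rw [hD, map_sub, map_sum]
      simp [MvPowerSeries.coeff_X, Finsupp.single_left_inj (one_ne_zero : (1 : ℕ) ≠ 0)]
  have hsub : MvPowerSeries.coeff (Finsupp.single i 1) (MvPowerSeries.subst G D) = 0 := by
    apply MvPowerSeries.coeff_of_lt_order
    have h1 : (1 : ℕ∞) ≤ ⨅ s, (G s).order :=
      le_iInf fun s => MvPowerSeries.one_le_order_iff_constCoeff_eq_zero.mpr (hG s)
    have := MvPowerSeries.le_order_subst hG' D
    rw [Finsupp.degree_single]
    calc ((1 : ℕ) : ℕ∞) < 1 * (2 : ℕ) := by norm_num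
      _ ≤ _ := mul_le_mul' h1 hord
      _ ≤ _ := this
  rw [hD, MvPowerSeries.subst_sub hG', ← MvPowerSeries.coe_substAlgHom hG', map_sum, map_sub,
    sub_eq_zero, map_sum] at hsub
  rw [← MvPowerSeries.coe_substAlgHom hG', hsub]
  refine Finset.sum_congr rfl fun s _ => ?_
  rw [map_smul, MvPowerSeries.substAlgHom_X, MvPowerSeries.coeff_smul]

lemma coeff_single_powerSeries_subst [Finite τ] {h : R⟦X⟧} (hh : PowerSeries.constantCoeff h = 0)
    {F : MvPowerSeries τ R} (hF : MvPowerSeries.constantCoeff F = 0) (i : τ) :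
    MvPowerSeries.coeff (Finsupp.single i 1) (PowerSeries.subst F h) =
      PowerSeries.coeff 1 h * MvPowerSeries.coeff (Finsupp.single i 1) F := by
  have := coeff_single_subst (σ := Unit) (F := h) hh (G := fun _ => F) (fun _ => hF) i
  rw [Fintype.sum_unique] at this
  exact this

lemma coeff_one_subst {h k : R⟦X⟧} (hh : PowerSeries.constantCoeff h = 0)
    (hk : PowerSeries.constantCoeff k = 0) :
    PowerSeries.coeff 1 (PowerSeries.subst k h) =
      PowerSeries.coeff 1 h * PowerSeries.coeff 1 k :=
  coeff_single_powerSeries_subst (τ := Unit) hh hk ()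

lemma constantCoeff_subst' {h k : R⟦X⟧} (hh : PowerSeries.constantCoeff h = 0)
    (hk : PowerSeries.constantCoeff k = 0) :
    PowerSeries.constantCoeff (PowerSeries.subst k h) = 0 :=
  PowerSeries.constantCoeff_subst_eq_zero (τ := Unit) hk h hh

lemma vec_eq_fun {A : Type*} (a : Fin 2 → A) : ![a 0, a 1] = a := by
  funext i
  fin_cases i <;> rfl

lemma coeff_single_formalGroup (F : FormalGroup R) (i : Fin 2) :
    MvPowerSeries.coeff (Finsupp.single i 1) F.toPowerSeries = 1 := by
  fin_cases i
  · exact F.lin_coeff_X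
  · exact F.lin_coeff_Y

lemma isFormalHom_iff {F G : FormalGroup R} {h : R⟦X⟧} :
    IsFormalHom F G h ↔ PowerSeries.constantCoeff h = 0 ∧
      PowerSeries.subst F.toPowerSeries h = MvPowerSeries.subst
        (fun i => PowerSeries.subst (MvPowerSeries.X i : MvPowerSeries (Fin 2) R) h)
          G.toPowerSeries := by
  rw [IsFormalHom, vec_eq_fun fun i => PowerSeries.subst
    (MvPowerSeries.X i : MvPowerSeries (Fin 2) R) h]

/-- For series in one variable, to intertwine is to satisfy `g ∘ h = h ∘ f`. -/
lemma intertwines_iff {f g h : R⟦X⟧} :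
    Intertwines (σ := Unit) f g h ↔ PowerSeries.subst h g = PowerSeries.subst f h := by
  have : (fun i : Unit => PowerSeries.subst (MvPowerSeries.X i : MvPowerSeries Unit R) f) =
      fun _ => f := funext fun i => PowerSeries.X_subst f
  rw [Intertwines, this]
  rfl

lemma Intertwines.powerSeries_comp [Finite τ] {e f g h : R⟦X⟧}
    (he : PowerSeries.constantCoeff e = 0) (hf : PowerSeries.constantCoeff f = 0)
    (hh : PowerSeries.constantCoeff h = 0) (hhi : Intertwines (σ := Unit) f g h)
    {G : MvPowerSeries τ R} (hG : MvPowerSeries.constantCoeff G = 0) (hGi : Intertwines e f G) :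
    Intertwines e g (PowerSeries.subst G h) :=
  Intertwines.comp (σ := Unit) he hf hh hhi (fun _ => hG) (fun _ => hGi)

lemma IsLubinTateLaw.intertwines {f : R⟦X⟧} {F : FormalGroup R} (hF : IsLubinTateLaw f F) :
    Intertwines f f F.toPowerSeries := (isFormalHom_iff.mp hF.2).2

/-- For every `a` there is a series `[a] = a x + ⋯` intertwining `f` and `g`. -/
lemma exists_intertwines_coeff_one {π : R} {q : ℕ} (hb : IsFrobeniusBase π q) {f g : R⟦X⟧}
    (hf : IsFrobeniusSeries π q f) (hg : IsFrobeniusSeries π q g) (a : R) :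
    ∃ h : R⟦X⟧, PowerSeries.constantCoeff h = 0 ∧ PowerSeries.coeff 1 h = a ∧
      Intertwines (σ := Unit) f g h := by
  obtain ⟨h, hi, h0, h1⟩ := exists_intertwines (σ := Unit) hb hf hg
    (L := (PowerSeries.C a * PowerSeries.X : R⟦X⟧)) (by
      show PowerSeries.constantCoeff _ = 0
      simp)
  refine ⟨h, h0, (h1 ()).trans ?_, hi⟩
  show PowerSeries.coeff 1 (PowerSeries.C a * PowerSeries.X) = a
  rw [PowerSeries.coeff_C_mul, PowerSeries.coeff_one_X, mul_one]

lemma coeff_one_of_X_sq_dvd_sub_X {h : R⟦X⟧} (hh : PowerSeries.X ^ 2 ∣ h - PowerSeries.X) :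
    PowerSeries.coeff 1 h = 1 := by
  have := PowerSeries.X_pow_dvd_iff.mp hh 1 (by norm_num)
  rwa [map_sub, PowerSeries.coeff_one_X, sub_eq_zero] at this

section Base

variable [IsDomain R] {π : R} {q : ℕ} (hb : IsFrobeniusBase π q)

include hb in
lemma IsFrobeniusBase.ext_of_intertwines [Finite σ] {f g : R⟦X⟧} (hf : IsFrobeniusSeries π q f)
    (hg : IsFrobeniusSeries π q g) {F G : MvPowerSeries σ R} (hFi : Intertwines f g F)
    (hGi : Intertwines f g G) (hF : MvPowerSeries.constantCoeff F = 0)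
    (hG : MvPowerSeries.constantCoeff G = 0)
    (h : ∀ i, MvPowerSeries.coeff (Finsupp.single i 1) F =
      MvPowerSeries.coeff (Finsupp.single i 1) G) : F = G :=
  hFi.ext hf.constantCoeff_eq (hf.coeff_one.trans hg.coeff_one.symm)
    (fun m hm => by rw [hf.coeff_one]; exact hb.pow_ne m hm) hGi hF hG h

include hb in
/-- The Lubin-Tate formal group law exists. Its associativity and commutativity hold because both
sides of these identities commute with `f` and have the same linear part. -/
theorem exists_isLubinTateLaw {f : R⟦X⟧} (hf : IsFrobeniusSeries π q f) :
    ∃ F, IsLubinTateLaw f F := by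
  obtain ⟨F, hFi, hF0, hF1⟩ := exists_intertwines (σ := Fin 2) hb hf hf
    (L := MvPowerSeries.X 0 + MvPowerSeries.X 1) (by simp)
  have hlin : ∀ i, MvPowerSeries.coeff (Finsupp.single i 1) F = 1 := by
    intro i
    rw [hF1]
    fin_cases i <;> simp [MvPowerSeries.coeff_index_single_X]
  have hf0 := hf.constantCoeff_eq
  have hvec : ∀ {τ : Type} [Finite τ] {A B : MvPowerSeries τ R},
      MvPowerSeries.constantCoeff A = 0 → MvPowerSeries.constantCoeff B = 0 →
      Intertwines f f A → Intertwines f f B →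
      MvPowerSeries.constantCoeff (MvPowerSeries.subst ![A, B] F) = 0 ∧
      Intertwines f f (MvPowerSeries.subst ![A, B] F) ∧
      ∀ i, MvPowerSeries.coeff (Finsupp.single i 1) (MvPowerSeries.subst ![A, B] F) =
        MvPowerSeries.coeff (Finsupp.single i 1) A +
          MvPowerSeries.coeff (Finsupp.single i 1) B := by
    intro τ _ A B hA hB hAi hBi
    have h0 : ∀ s, MvPowerSeries.constantCoeff (![A, B] s) = 0 := by
      intro s
      fin_cases s
      exacts [hA, hB]
    refine ⟨MvPowerSeries.constantCoeff_subst_eq_zero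
      (MvPowerSeries.hasSubst_of_constantCoeff_zero h0) h0 hF0, hFi.comp hf0 hf0 hF0 h0 ?_, ?_⟩
    · intro s
      fin_cases s
      exacts [hAi, hBi]
    · intro i
      rw [coeff_single_subst hF0 h0, Fin.sum_univ_two, hlin, hlin, one_mul, one_mul]
      rfl
  have hX : ∀ {τ : Type} (i : τ),
      MvPowerSeries.constantCoeff (MvPowerSeries.X i : MvPowerSeries τ R) = 0 :=
    fun i => MvPowerSeries.constantCoeff_X i
  have hXi : ∀ {τ : Type} [Finite τ] (i : τ),
      Intertwines f f (MvPowerSeries.X i : MvPowerSeries τ R) := fun i => intertwines_X hf0 i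
  let G : FormalGroup R :=
    { toPowerSeries := F
      zero_constantCoeff := hF0
      lin_coeff_X := hlin 0
      lin_coeff_Y := hlin 1
      assoc := by
        obtain ⟨a0, ai, al⟩ := hvec (hX (0 : Fin 3)) (hX 1) (hXi 0) (hXi 1)
        obtain ⟨b0, bi, bl⟩ := hvec (hX (1 : Fin 3)) (hX 2) (hXi 1) (hXi 2)
        obtain ⟨c0, ci, cl⟩ := hvec a0 (hX (2 : Fin 3)) ai (hXi 2)
        obtain ⟨d0, di, dl⟩ := hvec (hX (0 : Fin 3)) b0 (hXi 0) bi
        exact hb.ext_of_intertwines hf hf ci di c0 d0 fun i => by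
          rw [cl, dl, al, bl, add_assoc] }
  refine ⟨G, ⟨?_⟩, isFormalHom_iff.mpr ⟨hf0, hFi⟩⟩
  obtain ⟨a0, ai, al⟩ := hvec (hX (1 : Fin 2)) (hX 0) (hXi 1) (hXi 0)
  refine hb.ext_of_intertwines hf hf hFi ai hF0 a0 fun i => ?_
  rw [al, hlin]
  fin_cases i <;> simp [MvPowerSeries.coeff_index_single_X]

include hb in
theorem existsUnique_isLubinTateLaw {f : R⟦X⟧} (hf : IsFrobeniusSeries π q f) :
    ∃! F, IsLubinTateLaw f F := by
  obtain ⟨F, hF⟩ := exists_isLubinTateLaw hb hf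
  refine ⟨F, hF, fun G hG => FormalGroup.ext ?_⟩
  exact hb.ext_of_intertwines hf hf hG.intertwines hF.intertwines
    G.zero_constantCoeff F.zero_constantCoeff fun i => by
      rw [coeff_single_formalGroup, coeff_single_formalGroup]

include hb in
lemma isLubinTateLaw_groupLaw {f : R⟦X⟧} (hf : IsFrobeniusSeries π q f) :
    IsLubinTateLaw f (groupLaw f) :=
  Classical.epsilon_spec (exists_isLubinTateLaw hb hf)

include hb in
/-- A series without constant term that intertwines `f` and `g` is a homomorphism of the
corresponding formal group laws. -/
lemma isFormalHom_of_intertwines {f g : R⟦X⟧} (hf : IsFrobeniusSeries π q f)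
    (hg : IsFrobeniusSeries π q g) {F G : FormalGroup R} (hF : IsLubinTateLaw f F)
    (hG : IsLubinTateLaw g G) {h : R⟦X⟧} (h0 : PowerSeries.constantCoeff h = 0)
    (hi : Intertwines (σ := Unit) f g h) : IsFormalHom F G h := by
  rw [isFormalHom_iff]
  have hf0 := hf.constantCoeff_eq
  have hX : ∀ i : Fin 2, MvPowerSeries.constantCoeff
      (PowerSeries.subst (MvPowerSeries.X i : MvPowerSeries (Fin 2) R) h) = 0 :=
    fun i => constantCoeff_subst_X i h0
  have h1 : ∀ i s : Fin 2, MvPowerSeries.coeff (Finsupp.single i 1)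
      (PowerSeries.subst (MvPowerSeries.X s : MvPowerSeries (Fin 2) R) h) =
        PowerSeries.coeff 1 h * if i = s then 1 else 0 := fun i s => by
    rw [coeff_single_powerSeries_subst h0 (MvPowerSeries.constantCoeff_X s),
      MvPowerSeries.coeff_index_single_X]
  refine ⟨h0, hb.ext_of_intertwines hf hg
    (hi.powerSeries_comp hf0 hf0 h0 F.zero_constantCoeff hF.intertwines)
    (hG.intertwines.comp hf0 hg.constantCoeff_eq G.zero_constantCoeff hX
      fun i => hi.powerSeries_comp hf0 hf0 h0 (MvPowerSeries.constantCoeff_X i)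
        (intertwines_X hf0 i))
    (PowerSeries.constantCoeff_subst_eq_zero F.zero_constantCoeff h h0)
    (MvPowerSeries.constantCoeff_subst_eq_zero
      (MvPowerSeries.hasSubst_of_constantCoeff_zero hX) hX G.zero_constantCoeff) fun i => ?_⟩
  rw [coeff_single_powerSeries_subst h0 F.zero_constantCoeff, coeff_single_formalGroup,
    coeff_single_subst G.zero_constantCoeff hX]
  simp_rw [coeff_single_formalGroup, h1]
  simp

include hb in
/-- The series `r = x + ⋯` intertwining `f` and `g` is invertible, with inverse the series
`k = x + ⋯` intertwining `g` and `f`, as `k ∘ r` and `r ∘ k` commute with `f` and `g` respectively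
and are tangent to the identity. -/
theorem exists_isTangentIso {f g : R⟦X⟧} (hf : IsFrobeniusSeries π q f)
    (hg : IsFrobeniusSeries π q g) {F G : FormalGroup R} (hF : IsLubinTateLaw f F)
    (hG : IsLubinTateLaw g G) :
    ∃ r, IsTangentIso F G r ∧ PowerSeries.subst r g = PowerSeries.subst f r := by
  obtain ⟨r, hr0, hr1, hri⟩ := exists_intertwines_coeff_one hb hf hg 1
  obtain ⟨k, hk0, hk1, hki⟩ := exists_intertwines_coeff_one hb hg hf 1
  have hf0 := hf.constantCoeff_eq
  have hg0 := hg.constantCoeff_eq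
  have hX : ∀ {e : R⟦X⟧}, PowerSeries.constantCoeff e = 0 →
      Intertwines (σ := Unit) e e (PowerSeries.X : R⟦X⟧) := fun he => intertwines_X he ()
  have hid : ∀ {e h : R⟦X⟧}, IsFrobeniusSeries π q e → PowerSeries.constantCoeff h = 0 →
      PowerSeries.coeff 1 h = 1 → Intertwines (σ := Unit) e e h → h = PowerSeries.X := by
    intro e h he h0 h1 hi
    refine hb.ext_of_intertwines (σ := Unit) he he hi (hX he.constantCoeff_eq) h0
      PowerSeries.constantCoeff_X fun i => ?_
    exact h1.trans PowerSeries.coeff_one_X.symm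
  refine ⟨r, ⟨⟨isFormalHom_of_intertwines hb hf hg hF hG hr0 hri, k,
    isFormalHom_of_intertwines hb hg hf hG hF hk0 hki, ?_, ?_⟩, ?_⟩, intertwines_iff.mp hri⟩
  · exact hid hf (constantCoeff_subst' hk0 hr0) (by rw [coeff_one_subst hk0 hr0, hk1, hr1, one_mul])
      (hki.powerSeries_comp (τ := Unit) hf0 hg0 hk0 hr0 hri)
  · exact hid hg (constantCoeff_subst' hr0 hk0) (by rw [coeff_one_subst hr0 hk0, hk1, hr1, one_mul])
      (hri.powerSeries_comp (τ := Unit) hg0 hf0 hr0 hk0 hki)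
  · rw [PowerSeries.X_pow_dvd_iff]
    intro m hm
    interval_cases m
    · simpa using hr0
    · rw [map_sub, hr1, PowerSeries.coeff_one_X, sub_self]

end Base

/-- The series `[2]_F(x) = F(x, x)` of a formal group law. -/
def double (F : FormalGroup R) : R⟦X⟧ :=
  MvPowerSeries.subst (fun _ => (PowerSeries.X : R⟦X⟧)) F.toPowerSeries

lemma constantCoeff_double (F : FormalGroup R) : PowerSeries.constantCoeff (double F) = 0 :=
  MvPowerSeries.constantCoeff_subst_eq_zero
    (MvPowerSeries.hasSubst_of_constantCoeff_zero fun _ => PowerSeries.constantCoeff_X)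
    (fun _ => PowerSeries.constantCoeff_X) F.zero_constantCoeff

lemma coeff_one_double (F : FormalGroup R) : PowerSeries.coeff 1 (double F) = 2 := by
  have := coeff_single_subst (τ := Unit) F.zero_constantCoeff
    (G := fun _ => (PowerSeries.X : R⟦X⟧)) (fun _ => PowerSeries.constantCoeff_X) ()
  simp_rw [coeff_single_formalGroup, one_mul, Fin.sum_univ_two] at this
  refine this.trans ?_
  rw [← one_add_one_eq_two]
  congr 1 <;> exact PowerSeries.coeff_one_X

lemma IsFormalHom.intertwines_double {F G : FormalGroup R} {h : R⟦X⟧} (hh : IsFormalHom F G h) :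
    Intertwines (σ := Unit) (double F) (double G) h := by
  rw [intertwines_iff]
  obtain ⟨h0, hh⟩ := isFormalHom_iff.mp hh
  have hX : MvPowerSeries.HasSubst (fun _ : Fin 2 => (PowerSeries.X : R⟦X⟧)) :=
    MvPowerSeries.hasSubst_of_constantCoeff_zero fun _ => PowerSeries.constantCoeff_X
  have hh' : PowerSeries.HasSubst h := PowerSeries.HasSubst.of_constantCoeff_zero' h0
  have h1 : PowerSeries.subst (double F) h = MvPowerSeries.subst
      (fun _ => (PowerSeries.X : R⟦X⟧)) (PowerSeries.subst F.toPowerSeries h) := by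
    rw [PowerSeries.subst, PowerSeries.subst, MvPowerSeries.subst_comp_subst_apply
      (PowerSeries.HasSubst.of_constantCoeff_zero F.zero_constantCoeff).const hX]
    rfl
  rw [h1, hh, MvPowerSeries.subst_comp_subst_apply (hasSubst_subst_X h0) hX, double,
    PowerSeries.subst, MvPowerSeries.subst_comp_subst_apply hX hh'.const]
  congr 1
  funext i
  rw [PowerSeries.subst, MvPowerSeries.subst_comp_subst_apply (PowerSeries.HasSubst.X i).const hX]
  simp only [MvPowerSeries.subst_X hX]
  exact (PowerSeries.subst_X hh').trans (PowerSeries.X_subst h).symm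

/-- Over a domain of characteristic zero, a homomorphism of formal group laws is determined by its
linear coefficient, since it commutes with doubling. -/
theorem IsFormalHom.ext [IsDomain R] [CharZero R] {F G : FormalGroup R} {h k : R⟦X⟧}
    (hh : IsFormalHom F G h) (hk : IsFormalHom F G k)
    (h1 : PowerSeries.coeff 1 h = PowerSeries.coeff 1 k) : h = k := by
  refine Intertwines.ext (σ := Unit) (constantCoeff_double F)
    ((coeff_one_double F).trans (coeff_one_double G).symm) ?_ hh.intertwines_double
    hk.intertwines_double hh.1 hk.1 fun _ => h1
  intro m hm he
  rw [coeff_one_double] at he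
  have h2 : (2 : ℕ) ^ m = 2 := by exact_mod_cast he
  have := Nat.pow_lt_pow_right (a := 2) (by norm_num) (show 1 < m by omega)
  omega

theorem existsUnique_isTangentIso [IsDomain R] [CharZero R] {π : R} {q : ℕ}
    (hb : IsFrobeniusBase π q) {f g : R⟦X⟧} (hf : IsFrobeniusSeries π q f)
    (hg : IsFrobeniusSeries π q g) {F G : FormalGroup R} (hF : IsLubinTateLaw f F)
    (hG : IsLubinTateLaw g G) : ∃! r, IsTangentIso F G r := by
  obtain ⟨r, hr, -⟩ := exists_isTangentIso hb hf hg hF hG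
  exact ⟨r, hr, fun k hk => hk.1.1.ext hr.1.1
    ((coeff_one_of_X_sq_dvd_sub_X hk.2).trans (coeff_one_of_X_sq_dvd_sub_X hr.2).symm)⟩

/-- The isomorphism `r = i_{f,g}` satisfies `g ∘ r = r ∘ f`. -/
theorem isTangentIso_tangentIso [IsDomain R] [CharZero R] {π : R} {q : ℕ}
    (hb : IsFrobeniusBase π q) {f g : R⟦X⟧} (hf : IsFrobeniusSeries π q f)
    (hg : IsFrobeniusSeries π q g) :
    IsTangentIso (groupLaw f) (groupLaw g) (tangentIso f g) ∧
      PowerSeries.subst (tangentIso f g) g = PowerSeries.subst f (tangentIso f g) := by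
  have hF := isLubinTateLaw_groupLaw hb hf
  have hG := isLubinTateLaw_groupLaw hb hg
  obtain ⟨r, hr, hc⟩ := exists_isTangentIso hb hf hg hF hG
  have hs : IsTangentIso (groupLaw f) (groupLaw g) (tangentIso f g) :=
    Classical.epsilon_spec ⟨r, hr⟩
  rw [(existsUnique_isTangentIso hb hf hg hF hG).unique hs hr]
  exact ⟨hr, hc⟩

end FormalGroups

/-! ### Values of series and of formal group laws in linearly topologized rings -/

section Evaluation

variable {R : Type*} [CommRing R] {σ τ : Type*}

section Def

variable {A : Type*} [CommRing A] [Algebra R A] [UniformSpace A]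

/-- The value `F(a)` of a power series at a family of topologically nilpotent elements of an
algebra. The coefficient ring carries the discrete topology, so that no continuity has to be asked
of the structure map. -/
def evalAt (a : σ → A) (F : MvPowerSeries σ R) : A :=
  letI : UniformSpace R := ⊥
  MvPowerSeries.eval₂ (algebraMap R A) a F

/-- The value of a power series in one variable. -/
def evalOne (a : A) (h : R⟦X⟧) : A := evalAt (fun _ : Unit => a) h

/-- The sum of two topologically nilpotent elements under a formal group law. -/
def lawSum (F : FormalGroup R) (a b : A) : A := evalAt ![a, b] F.toPowerSeries

lemma hasEval_of_finite [Finite σ] {a : σ → A} (ha : ∀ s, IsTopologicallyNilpotent (a s)) :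
    MvPowerSeries.HasEval a := ⟨ha, by simp⟩

lemma hasEval_vec {a b : A} (ha : IsTopologicallyNilpotent a) (hb : IsTopologicallyNilpotent b) :
    MvPowerSeries.HasEval ![a, b] := hasEval_of_finite fun s => by
  fin_cases s
  exacts [ha, hb]

lemma evalAt_X (a : σ → A) (s : σ) :
    evalAt a (MvPowerSeries.X s : MvPowerSeries σ R) = a s := by
  let _ : UniformSpace R := ⊥
  exact MvPowerSeries.eval₂_X _ _ s

lemma evalOne_X (a : A) : evalOne a (PowerSeries.X : R⟦X⟧) = a := evalAt_X _ ()

lemma evalOne_polynomial (a : A) (p : Polynomial R) :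
    evalOne a (p : R⟦X⟧) = Polynomial.aeval a p := by
  let _ : UniformSpace R := ⊥
  exact PowerSeries.eval₂_coe _ _ p

end Def

variable {A : Type*} [CommRing A] [Algebra R A] [UniformSpace A]
  [IsUniformAddGroup A] [IsTopologicalRing A] [IsLinearTopology A A] [T2Space A] [CompleteSpace A]
  {A' : Type*} [CommRing A'] [Algebra R A'] [UniformSpace A']
  [IsUniformAddGroup A'] [IsTopologicalRing A'] [IsLinearTopology A' A'] [T2Space A']
  [CompleteSpace A']

lemma hasSum_evalAt {a : σ → A} (ha : MvPowerSeries.HasEval a) (F : MvPowerSeries σ R) :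
    HasSum (fun d : σ →₀ ℕ => algebraMap R A (MvPowerSeries.coeff d F) *
      d.prod fun s e => a s ^ e) (evalAt a F) := by
  let _ : UniformSpace R := ⊥
  exact MvPowerSeries.hasSum_eval₂ continuous_of_discreteTopology ha F

lemma hasSum_evalOne {a : A} (ha : IsTopologicallyNilpotent a) (h : R⟦X⟧) :
    HasSum (fun n : ℕ => algebraMap R A (PowerSeries.coeff n h) * a ^ n) (evalOne a h) := by
  let _ : UniformSpace R := ⊥
  exact PowerSeries.hasSum_eval₂ continuous_of_discreteTopology ha h

lemma evalOne_add {a : A} (ha : IsTopologicallyNilpotent a) (h k : R⟦X⟧) :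
    evalOne a (h + k) = evalOne a h + evalOne a k := by
  let _ : UniformSpace R := ⊥
  have := map_add (PowerSeries.eval₂Hom (continuous_of_discreteTopology (f := algebraMap R A)) ha)
    h k
  rwa [PowerSeries.coe_eval₂Hom] at this

lemma evalOne_mul {a : A} (ha : IsTopologicallyNilpotent a) (h k : R⟦X⟧) :
    evalOne a (h * k) = evalOne a h * evalOne a k := by
  let _ : UniformSpace R := ⊥
  have := map_mul (PowerSeries.eval₂Hom (continuous_of_discreteTopology (f := algebraMap R A)) ha)
    h k
  rwa [PowerSeries.coe_eval₂Hom] at this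

lemma evalAt_zero {a : σ → A} (ha : MvPowerSeries.HasEval a) :
    evalAt a (0 : MvPowerSeries σ R) = 0 := by
  have := hasSum_evalAt ha (0 : MvPowerSeries σ R)
  simp only [map_zero, zero_mul] at this
  exact this.unique hasSum_zero

lemma evalAt_subst {G : σ → MvPowerSeries τ R} (hG : MvPowerSeries.HasSubst G) {b : τ → A}
    (hb : MvPowerSeries.HasEval b) (F : MvPowerSeries σ R) :
    evalAt b (MvPowerSeries.subst G F) = evalAt (fun s => evalAt b (G s)) F := by
  let _ : UniformSpace R := ⊥
  exact MvPowerSeries.eval₂_subst hG hb F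

lemma map_evalAt {ε : A →+* A'} (hε : Continuous ε)
    (hc : ∀ c : R, ε (algebraMap R A c) = algebraMap R A' c) {a : σ → A}
    (ha : MvPowerSeries.HasEval a) (F : MvPowerSeries σ R) :
    ε (evalAt a F) = evalAt (fun s => ε (a s)) F := by
  let _ : UniformSpace R := ⊥
  have := congrFun (MvPowerSeries.comp_eval₂ (φ := algebraMap R A) continuous_of_discreteTopology
    ha hε) F
  rw [show ε.comp (algebraMap R A) = algebraMap R A' from RingHom.ext hc] at this
  exact this

open scoped MvPowerSeries.WithPiTopology in
lemma isTopologicallyNilpotent_evalAt {a : σ → A} (ha : MvPowerSeries.HasEval a)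
    {F : MvPowerSeries σ R} (hF : MvPowerSeries.constantCoeff F = 0) :
    IsTopologicallyNilpotent (evalAt a F) := by
  let _ : UniformSpace R := ⊥
  have hc : Continuous (algebraMap R A) := continuous_of_discreteTopology
  have h := IsTopologicallyNilpotent.map (φ := MvPowerSeries.eval₂Hom hc ha) (by
      rw [MvPowerSeries.coe_eval₂Hom]
      exact MvPowerSeries.continuous_eval₂ hc ha)
    (MvPowerSeries.WithPiTopology.isTopologicallyNilpotent_of_constantCoeff_zero hF)
  rwa [MvPowerSeries.coe_eval₂Hom] at h

section OneVariable

variable {a b : A} (ha : IsTopologicallyNilpotent a) (hb : IsTopologicallyNilpotent b)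

include ha

lemma isTopologicallyNilpotent_evalOne {h : R⟦X⟧} (hh : PowerSeries.constantCoeff h = 0) :
    IsTopologicallyNilpotent (evalOne a h) :=
  isTopologicallyNilpotent_evalAt (hasEval_of_finite fun _ => ha) hh

lemma evalOne_subst {k : R⟦X⟧} (hk : PowerSeries.constantCoeff k = 0) (h : R⟦X⟧) :
    evalOne a (PowerSeries.subst k h) = evalOne (evalOne a k) h :=
  evalAt_subst (PowerSeries.HasSubst.of_constantCoeff_zero hk).const
    (hasEval_of_finite fun _ => ha) h

lemma lawSum_zero (F : FormalGroup R) : lawSum F a 0 = a := by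
  have h := congrArg (evalOne a) F.Xzero_eq_X
  have hE : MvPowerSeries.HasEval (fun _ : Unit => a) := hasEval_of_finite fun _ => ha
  have hs : MvPowerSeries.HasSubst (![PowerSeries.X, 0] : Fin 2 → R⟦X⟧) :=
    MvPowerSeries.HasSubst.X_zero
  rw [evalOne_X, FormalGroup.Xzero, evalOne, evalAt_subst hs hE] at h
  refine Eq.trans ?_ h
  rw [lawSum]
  congr 1
  funext s
  fin_cases s
  · exact (evalOne_X (R := R) a).symm
  · exact (evalAt_zero hE).symm

lemma zero_lawSum (F : FormalGroup R) : lawSum F 0 a = a := by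
  have h := congrArg (evalOne a) F.zeroX_eq_X
  have hE : MvPowerSeries.HasEval (fun _ : Unit => a) := hasEval_of_finite fun _ => ha
  have hs : MvPowerSeries.HasSubst (![0, PowerSeries.X] : Fin 2 → R⟦X⟧) :=
    MvPowerSeries.HasSubst.zero_X
  rw [evalOne_X, FormalGroup.zeroX, evalOne, evalAt_subst hs hE] at h
  refine Eq.trans ?_ h
  rw [lawSum]
  congr 1
  funext s
  fin_cases s
  · exact (evalAt_zero hE).symm
  · exact (evalOne_X (R := R) a).symm

lemma evalOne_subst_law (F : FormalGroup R) {h k : R⟦X⟧} (hh : PowerSeries.constantCoeff h = 0)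
    (hk : PowerSeries.constantCoeff k = 0) :
    evalOne a (MvPowerSeries.subst ![h, k] F.toPowerSeries : R⟦X⟧) =
      lawSum F (evalOne a h) (evalOne a k) := by
  have h0 : ∀ s, MvPowerSeries.constantCoeff ((![h, k] : Fin 2 → R⟦X⟧) s) = 0 := by
    intro s
    fin_cases s
    exacts [hh, hk]
  rw [evalOne, evalAt_subst (MvPowerSeries.hasSubst_of_constantCoeff_zero h0)
    (hasEval_of_finite fun _ => ha), lawSum]
  congr 1
  funext s
  fin_cases s <;> rfl

include hb

lemma isTopologicallyNilpotent_lawSum (F : FormalGroup R) :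
    IsTopologicallyNilpotent (lawSum F a b) :=
  isTopologicallyNilpotent_evalAt (hasEval_vec ha hb) F.zero_constantCoeff

lemma evalOne_lawSum {F G : FormalGroup R} {h : R⟦X⟧} (hh : IsFormalHom F G h) :
    evalOne (lawSum F a b) h = lawSum G (evalOne a h) (evalOne b h) := by
  obtain ⟨h0, hh⟩ := isFormalHom_iff.mp hh
  have hE := hasEval_vec ha hb
  have := congrArg (evalAt ![a, b]) hh
  rw [PowerSeries.subst, evalAt_subst
    (PowerSeries.HasSubst.of_constantCoeff_zero F.zero_constantCoeff).const hE,
    evalAt_subst (hasSubst_subst_X h0) hE] at this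
  refine this.trans ?_
  rw [lawSum]
  congr 1
  funext s
  rw [PowerSeries.subst, evalAt_subst (PowerSeries.HasSubst.X s).const hE]
  simp only [evalAt_X]
  fin_cases s <;> rfl

end OneVariable

lemma map_evalOne {ε : A →+* A'} (hε : Continuous ε)
    (hc : ∀ c : R, ε (algebraMap R A c) = algebraMap R A' c) {a : A}
    (ha : IsTopologicallyNilpotent a) (h : R⟦X⟧) : ε (evalOne a h) = evalOne (ε a) h :=
  map_evalAt hε hc (hasEval_of_finite fun _ => ha) h

lemma map_lawSum {ε : A →+* A'} (hε : Continuous ε)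
    (hc : ∀ c : R, ε (algebraMap R A c) = algebraMap R A' c) {a b : A}
    (ha : IsTopologicallyNilpotent a) (hb : IsTopologicallyNilpotent b) (F : FormalGroup R) :
    ε (lawSum F a b) = lawSum F (ε a) (ε b) := by
  rw [lawSum, map_evalAt hε hc (hasEval_vec ha hb), lawSum]
  congr 1
  funext s
  fin_cases s <;> rfl

/-- A convergent evaluation taken in a complete algebra `A` and mapped to a topological algebra `B`
is the value there. -/
lemma evalSeries_map {K : Type*} [NormedField K] [IsUltrametricDist K] [Algebra (integers K) A]
    {B : Type*} [CommRing B] [Algebra K B] [TopologicalSpace B] [T2Space B] {φ : A →+* B}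
    (hφ : Continuous φ) (hc : ∀ c : integers K, φ (algebraMap (integers K) A c) =
      algebraMap K B (algebraMap (integers K) K c)) {a : A} (ha : IsTopologicallyNilpotent a)
    (h : (integers K)⟦X⟧) : evalSeries h (φ a) = φ (evalOne a h) := by
  have := (hasSum_evalOne ha h).map φ hφ
  rw [evalSeries, ← this.tsum_eq]
  congr 1
  funext n
  rw [Function.comp_apply, map_mul, map_pow, hc]

lemma evalLaw_map {K : Type*} [NormedField K] [IsUltrametricDist K] [Algebra (integers K) A]
    {B : Type*} [CommRing B] [Algebra K B] [TopologicalSpace B] [T2Space B] {φ : A →+* B}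
    (hφ : Continuous φ) (hc : ∀ c : integers K, φ (algebraMap (integers K) A c) =
      algebraMap K B (algebraMap (integers K) K c)) {a b : A} (ha : IsTopologicallyNilpotent a)
    (hb : IsTopologicallyNilpotent b) (F : FormalGroup (integers K)) :
    evalLaw F (φ a) (φ b) = φ (lawSum F a b) := by
  have := (hasSum_evalAt (hasEval_vec ha hb) F.toPowerSeries).map φ hφ
  rw [evalLaw, lawSum, ← this.tsum_eq]
  congr 1
  funext d
  rw [Function.comp_apply, map_mul, hc, Finsupp.prod_fintype _ _ (fun _ => pow_zero _),
    Fin.prod_univ_two, map_mul, map_pow, map_pow]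
  rfl

end Evaluation

/-! ### Values at points of the open unit disc -/

section UnitBall

lemma exists_mem_finiteDimensional {K Ω : Type*} [Field K] [Field Ω] [Algebra K Ω]
    [Algebra.IsAlgebraic K Ω] (s : Set Ω) (hs : s.Finite) :
    ∃ L : IntermediateField K Ω, FiniteDimensional K L ∧ s ⊆ L := by
  have := hs.to_subtype
  exact ⟨IntermediateField.adjoin K s, IntermediateField.finiteDimensional_adjoin
    fun x _ => Algebra.IsIntegral.isIntegral x, IntermediateField.subset_adjoin K s⟩

variable {K : Type*} [NormedField K] [IsUltrametricDist K] {Ω : Type*} [NormedField Ω]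
  [NormedAlgebra K Ω]

lemma mem_integers_iff {x : K} : x ∈ integers K ↔ ‖x‖ ≤ 1 := by
  rw [Valuation.mem_valuationSubring_iff]
  rfl

lemma norm_integers_le_one (c : integers K) : ‖(c : K)‖ ≤ 1 := mem_integers_iff.mp c.2

lemma algebraMap_integers_apply (c : integers K) :
    algebraMap (integers K) Ω c = algebraMap K Ω (c : K) := rfl

lemma norm_algebraMap_integers (c : integers K) : ‖algebraMap (integers K) Ω c‖ = ‖(c : K)‖ := by
  rw [algebraMap_integers_apply, norm_algebraMap']

variable [IsUltrametricDist Ω]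

/-- The ring of elements of absolute value at most `1` of an intermediate field. -/
def unitBall (L : IntermediateField K Ω) : Subalgebra (integers K) Ω where
  carrier := {x | x ∈ L ∧ ‖x‖ ≤ 1}
  mul_mem' := fun {x y} hx hy => ⟨mul_mem hx.1 hy.1, by
    rw [norm_mul]
    exact mul_le_one₀ hx.2 (norm_nonneg _) hy.2⟩
  add_mem' := fun {x y} hx hy => ⟨add_mem hx.1 hy.1,
    (IsUltrametricDist.norm_add_le_max x y).trans (max_le hx.2 hy.2)⟩
  algebraMap_mem' := fun c => ⟨L.algebraMap_mem c, by
    rw [norm_algebraMap_integers]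
    exact norm_integers_le_one c⟩

variable {L : IntermediateField K Ω}

/-- The balls around `0` are ideals of the unit ball, since the norm is nonarchimedean. -/
instance : IsLinearTopology (unitBall L) (unitBall L) := by
  -- `max ε 0` in place of `ε` keeps `0` in the ball for negative `ε`
  let s : ℝ → Submodule (unitBall L) (unitBall L) := fun ε =>
    { carrier := {x | ‖x‖ ≤ max ε 0}
      add_mem' := fun {x y} hx hy =>
        (IsUltrametricDist.norm_add_le_max (x : Ω) y).trans (max_le hx hy)
      zero_mem' := by
        show ‖(0 : unitBall L)‖ ≤ max ε 0
        rw [norm_zero]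
        exact le_max_right _ _
      smul_mem' := fun c x hx => by
        show ‖(c : Ω) * x‖ ≤ max ε 0
        rw [norm_mul]
        exact (mul_le_of_le_one_left (norm_nonneg _) c.2.2).trans hx }
  refine IsLinearTopology.mk_of_hasBasis (unitBall L) (ι := ℝ) (p := fun ε => 0 < ε) (s := s) ?_
  refine Metric.nhds_basis_closedBall.congr (fun _ => Iff.rfl) fun ε hε => ?_
  ext x
  rw [mem_closedBall_zero_iff]
  show ‖x‖ ≤ ε ↔ ‖x‖ ≤ max ε 0
  rw [max_eq_left hε.le]

lemma isTopologicallyNilpotent_unitBall_iff {x : unitBall L} :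
    IsTopologicallyNilpotent x ↔ ‖(x : Ω)‖ < 1 := by
  rw [IsTopologicallyNilpotent, tendsto_zero_iff_norm_tendsto_zero]
  have : ∀ n, ‖x ^ n‖ = ‖(x : Ω)‖ ^ n := fun n => by
    show ‖((x ^ n : unitBall L) : Ω)‖ = _
    rw [SubmonoidClass.coe_pow, norm_pow]
  simp_rw [this]
  rw [tendsto_pow_atTop_nhds_zero_iff, abs_of_nonneg (norm_nonneg _)]

/-- The unit ball of a finite extension of a complete field is complete. -/
lemma completeSpace_unitBall [CompleteSpace K] (hK : ∃ x : K, 1 < ‖x‖) [FiniteDimensional K L] :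
    CompleteSpace (unitBall L) := by
  let _ : NontriviallyNormedField K := { ‹NormedField K› with non_trivial := hK }
  have h1 : IsComplete ((L.toSubalgebra.toSubmodule : Submodule K Ω) : Set Ω) := by
    have : FiniteDimensional K L.toSubalgebra.toSubmodule := ‹FiniteDimensional K L›
    exact Submodule.complete_of_finiteDimensional _
  have h2 : ((unitBall L : Subalgebra (integers K) Ω) : Set Ω) =
      (L.toSubalgebra.toSubmodule : Set Ω) ∩ Metric.closedBall 0 1 := by
    ext x
    rw [Set.mem_inter_iff, mem_closedBall_zero_iff]
    rfl
  have h3 : IsComplete ((unitBall L : Subalgebra (integers K) Ω) : Set Ω) := by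
    rw [h2]
    intro f hf hle
    have := hf.1
    obtain ⟨x, hx, hfx⟩ := h1 f hf (hle.trans (Filter.principal_mono.mpr Set.inter_subset_left))
    exact ⟨x, ⟨hx, Metric.isClosed_closedBall.mem_of_tendsto (Filter.tendsto_id'.mpr hfx)
      (Filter.le_principal_iff.mp
        (hle.trans (Filter.principal_mono.mpr Set.inter_subset_right)))⟩, hfx⟩
  exact h3.completeSpace_coe

lemma continuous_unitBall_val : Continuous (unitBall L).val :=
  continuous_subtype_val

section Values

variable [CompleteSpace K] (hK : ∃ x : K, 1 < ‖x‖) [FiniteDimensional K L]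

include hK

lemma evalSeries_coe (x : unitBall L) (hx : ‖(x : Ω)‖ < 1) (h : (integers K)⟦X⟧) :
    evalSeries h (x : Ω) = (evalOne x h : unitBall L) := by
  have := completeSpace_unitBall (L := L) hK
  exact evalSeries_map (φ := ((unitBall L).val : unitBall L →+* Ω)) continuous_unitBall_val
    (fun _ => rfl) (isTopologicallyNilpotent_unitBall_iff.mpr hx) h

lemma evalLaw_coe (x y : unitBall L) (hx : ‖(x : Ω)‖ < 1) (hy : ‖(y : Ω)‖ < 1)
    (F : FormalGroup (integers K)) :
    evalLaw F (x : Ω) (y : Ω) = (lawSum F x y : unitBall L) := by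
  have := completeSpace_unitBall (L := L) hK
  exact evalLaw_map (φ := ((unitBall L).val : unitBall L →+* Ω)) continuous_unitBall_val
    (fun _ => rfl) (isTopologicallyNilpotent_unitBall_iff.mpr hx)
    (isTopologicallyNilpotent_unitBall_iff.mpr hy) F

end Values

section Algebraic

variable [CompleteSpace K] (hK : ∃ x : K, 1 < ‖x‖) [Algebra.IsAlgebraic K Ω]

include hK

variable {x : Ω} (hx : ‖x‖ < 1)

include hx

/-- Values of integral series lie in every intermediate field that contains the point: the field
generated by the point is complete, being of finite degree over `K`. -/
lemma evalSeries_mem {L : IntermediateField K Ω} (hxL : x ∈ L) (h : (integers K)⟦X⟧) :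
    evalSeries h x ∈ L := by
  have : FiniteDimensional K (IntermediateField.adjoin K {x}) :=
    IntermediateField.adjoin.finiteDimensional (Algebra.IsIntegral.isIntegral x)
  have hle : IntermediateField.adjoin K {x} ≤ L := by
    rwa [IntermediateField.adjoin_simple_le_iff]
  rw [evalSeries_coe hK (⟨x, IntermediateField.mem_adjoin_simple_self K x, hx.le⟩ :
    unitBall (IntermediateField.adjoin K {x})) hx h]
  exact hle (evalOne _ h : unitBall (IntermediateField.adjoin K {x})).2.1

/-- A point of the open unit disc, as a topologically nilpotent element of a suitable unit ball. -/
lemma exists_unitBall_eq : ∃ (L : IntermediateField K Ω) (a : unitBall L),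
    FiniteDimensional K L ∧ CompleteSpace (unitBall L) ∧ IsTopologicallyNilpotent a ∧
      (a : Ω) = x := by
  obtain ⟨L, hL, hs⟩ := exists_mem_finiteDimensional (K := K) {x} (Set.finite_singleton x)
  exact ⟨L, ⟨x, hs rfl, hx.le⟩, hL, completeSpace_unitBall hK,
    isTopologicallyNilpotent_unitBall_iff.mpr hx, rfl⟩

lemma norm_evalSeries_le_one (h : (integers K)⟦X⟧) : ‖evalSeries h x‖ ≤ 1 := by
  obtain ⟨L, a, _, _, ha, rfl⟩ := exists_unitBall_eq hK hx
  rw [evalSeries_coe hK a hx]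
  exact (evalOne a h).2.2

lemma norm_evalSeries_lt_one {h : (integers K)⟦X⟧} (h0 : PowerSeries.constantCoeff h = 0) :
    ‖evalSeries h x‖ < 1 := by
  obtain ⟨L, a, _, _, ha, rfl⟩ := exists_unitBall_eq hK hx
  rw [evalSeries_coe hK a hx]
  exact isTopologicallyNilpotent_unitBall_iff.mp (isTopologicallyNilpotent_evalOne ha h0)

/-- Substitution of series is composition of their values. -/
lemma evalSeries_subst {k : (integers K)⟦X⟧} (hk : PowerSeries.constantCoeff k = 0)
    (h : (integers K)⟦X⟧) :
    evalSeries (PowerSeries.subst k h) x = evalSeries h (evalSeries k x) := by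
  obtain ⟨L, a, _, _, ha, rfl⟩ := exists_unitBall_eq hK hx
  rw [evalSeries_coe hK a hx, evalSeries_coe hK a hx, evalOne_subst ha hk, evalSeries_coe hK]
  exact isTopologicallyNilpotent_unitBall_iff.mp (isTopologicallyNilpotent_evalOne ha hk)

lemma evalSeries_polynomial (p : Polynomial (integers K)) :
    evalSeries (p : (integers K)⟦X⟧) x = Polynomial.aeval x p := by
  obtain ⟨L, a, _, _, ha, rfl⟩ := exists_unitBall_eq hK hx
  rw [evalSeries_coe hK a hx, evalOne_polynomial]
  exact (Polynomial.aeval_algHom_apply (unitBall L).val a p).symm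

lemma evalSeries_X : evalSeries (PowerSeries.X : (integers K)⟦X⟧) x = x := by
  rw [← Polynomial.coe_X, evalSeries_polynomial hK hx, Polynomial.aeval_X]

lemma evalSeries_add (h k : (integers K)⟦X⟧) :
    evalSeries (h + k) x = evalSeries h x + evalSeries k x := by
  obtain ⟨L, a, _, _, ha, rfl⟩ := exists_unitBall_eq hK hx
  simp only [evalSeries_coe hK a hx, evalOne_add ha, AddMemClass.coe_add]

lemma evalSeries_mul (h k : (integers K)⟦X⟧) :
    evalSeries (h * k) x = evalSeries h x * evalSeries k x := by
  obtain ⟨L, a, _, _, ha, rfl⟩ := exists_unitBall_eq hK hx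
  simp only [evalSeries_coe hK a hx, evalOne_mul ha, MulMemClass.coe_mul]

/-- The value of `c + x u(x)` at a point of the open unit disc. -/
lemma evalSeries_C_add_X_mul (c : integers K) (u : (integers K)⟦X⟧) :
    evalSeries (PowerSeries.C c + PowerSeries.X * u) x =
      algebraMap K Ω c + x * evalSeries u x := by
  rw [evalSeries_add hK hx, evalSeries_mul hK hx, evalSeries_X hK hx, ← Polynomial.coe_C,
    evalSeries_polynomial hK hx, Polynomial.aeval_C]
  rfl

lemma evalSeries_subst_law (F : FormalGroup (integers K)) {h k : (integers K)⟦X⟧}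
    (hh : PowerSeries.constantCoeff h = 0) (hk : PowerSeries.constantCoeff k = 0) :
    evalSeries (MvPowerSeries.subst ![h, k] F.toPowerSeries : (integers K)⟦X⟧) x =
      evalLaw F (evalSeries h x) (evalSeries k x) := by
  obtain ⟨L, a, _, _, ha, rfl⟩ := exists_unitBall_eq hK hx
  rw [evalSeries_coe hK a hx, evalSeries_coe hK a hx, evalSeries_coe hK a hx,
    evalOne_subst_law ha F hh hk, evalLaw_coe hK]
  · exact isTopologicallyNilpotent_unitBall_iff.mp (isTopologicallyNilpotent_evalOne ha hh)
  · exact isTopologicallyNilpotent_unitBall_iff.mp (isTopologicallyNilpotent_evalOne ha hk)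

end Algebraic

end UnitBall

/-! ### Zeros of the polynomial `g` -/

/-- A monic polynomial over a domain with as many distinct zeros as its degree. -/
lemma eq_prod_X_sub_C_of_injective {B ι : Type*} [CommRing B] [IsDomain B] [Fintype ι]
    {P : Polynomial B} (hP : P.Monic) {t : ι → B} (ht : Function.Injective t)
    (hroot : ∀ i, P.IsRoot (t i)) (hcard : P.natDegree = Fintype.card ι) :
    P = ∏ i, (Polynomial.X - Polynomial.C (t i)) := by
  classical
  have hle : Finset.univ.val.map t ≤ P.roots := by
    rw [Multiset.le_iff_subset (Multiset.Nodup.map ht Finset.univ.nodup)]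
    intro x hx
    obtain ⟨i, -, rfl⟩ := Multiset.mem_map.mp hx
    exact (Polynomial.mem_roots hP.ne_zero).mpr (hroot i)
  have heq : Finset.univ.val.map t = P.roots := by
    refine Multiset.eq_of_le_of_card_le hle ?_
    rw [Multiset.card_map]
    exact (Polynomial.card_roots' P).trans hcard.le
  have := Polynomial.prod_multiset_X_sub_C_of_monic_of_roots_card_eq hP (by
    rw [← heq, Multiset.card_map, hcard]
    rfl)
  rw [← this, ← heq, Multiset.map_map]
  rfl

section Integers

variable {K : Type*} [NormedField K] [IsUltrametricDist K]

lemma isUnit_integers_iff {c : integers K} : IsUnit c ↔ ‖(c : K)‖ = 1 := by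
  constructor
  · rintro ⟨u, rfl⟩
    refine le_antisymm (norm_integers_le_one _) ?_
    have h1 : ‖((u : integers K) : K)‖ * ‖((↑u⁻¹ : integers K) : K)‖ = 1 := by
      rw [← norm_mul, ← norm_one (α := K)]
      exact congrArg (fun a : integers K => ‖(a : K)‖) u.mul_inv
    calc (1 : ℝ) = _ := h1.symm
      _ ≤ _ := mul_le_of_le_one_right (norm_nonneg _) (norm_integers_le_one _)
  · intro h
    have hc : (c : K) ≠ 0 := by
      rw [← norm_ne_zero_iff, h]
      exact one_ne_zero
    refine IsUnit.of_mul_eq_one ⟨(c : K)⁻¹, mem_integers_iff.mpr ?_⟩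
      (Subtype.ext (mul_inv_cancel₀ hc))
    rw [norm_inv, h, inv_one]

variable {π : integers K} (hπ : Irreducible π)

include hπ

lemma norm_uniformizer_pos : 0 < ‖(π : K)‖ :=
  norm_pos_iff.mpr fun h => hπ.ne_zero (Subtype.ext h)

lemma norm_uniformizer_lt_one : ‖(π : K)‖ < 1 :=
  lt_of_le_of_ne (norm_integers_le_one π) fun h => hπ.not_isUnit (isUnit_integers_iff.mpr h)

lemma exists_one_lt_norm : ∃ x : K, 1 < ‖x‖ :=
  ⟨(π : K)⁻¹, by
    rw [norm_inv]
    exact (one_lt_inv₀ (norm_uniformizer_pos hπ)).mpr (norm_uniformizer_lt_one hπ)⟩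

/-- An irreducible element of the ring of integers divides every non-unit: of two elements of a
valuation ring one divides the other. -/
lemma uniformizer_dvd {c : integers K} (hc : ‖(c : K)‖ < 1) : π ∣ c := by
  rcases ValuationRing.dvd_total π c with h | h
  · exact h
  · obtain ⟨u, hu⟩ := h
    have hcu : ¬ IsUnit c := fun h => hc.ne (isUnit_integers_iff.mp h)
    have := (hπ.isUnit_or_isUnit hu).resolve_left hcu
    obtain ⟨v, rfl⟩ := this
    exact ⟨↑v⁻¹, by rw [hu, mul_assoc, Units.mul_inv, mul_one]⟩

lemma uniformizer_dvd_iff {c : integers K} : π ∣ c ↔ ‖(c : K)‖ < 1 := by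
  refine ⟨?_, uniformizer_dvd hπ⟩
  rintro ⟨d, rfl⟩
  show ‖(π : K) * d‖ < 1
  rw [norm_mul]
  exact mul_lt_one_of_nonneg_of_lt_one_left (norm_nonneg _) (norm_uniformizer_lt_one hπ)
    (norm_integers_le_one d)

lemma isMaximal_span_uniformizer : (Ideal.span {π}).IsMaximal := by
  have : Ideal.span {π} = IsLocalRing.maximalIdeal (integers K) := by
    ext c
    rw [Ideal.mem_span_singleton, uniformizer_dvd_iff hπ, IsLocalRing.mem_maximalIdeal,
      mem_nonunits_iff, isUnit_integers_iff]
    exact ⟨fun h => h.ne, fun h => lt_of_le_of_ne (norm_integers_le_one c) h⟩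
  rw [this]
  infer_instance

/-- A uniformizer of a finite extension of `ℚ_p` satisfies the hypotheses of the Lubin-Tate
lemma. The residue field is finite because a series that is congruent to `x ^ q` modulo `π` and has
no constant term can exist only for `q ≠ 0`. -/
lemma isFrobeniusBase {p : ℕ} [hp : Fact p.Prime] (hpK : ‖(p : K)‖ < 1) {q : ℕ}
    (hq : q = Nat.card (integers K ⧸ Ideal.span {π})) {f : (integers K)⟦X⟧}
    (hf : IsFrobeniusSeries π q f) :
    IsFrobeniusBase π q ∧ ∃ r, r ≠ 0 ∧ q = p ^ r := by
  have hmax := isMaximal_span_uniformizer hπ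
  have hq0 : q ≠ 0 := by
    rintro rfl
    have h1 := hf.map_mk
    have h2 := congrArg PowerSeries.constantCoeff h1
    rw [pow_zero, map_one, ← PowerSeries.coeff_zero_eq_constantCoeff_apply, PowerSeries.coeff_map,
      PowerSeries.coeff_zero_eq_constantCoeff_apply, hf.constantCoeff_eq, map_zero] at h2
    exact zero_ne_one h2
  have hfin : Finite (integers K ⧸ Ideal.span {π}) := Nat.finite_of_card_ne_zero (hq ▸ hq0)
  let _ : Field (integers K ⧸ Ideal.span {π}) := Ideal.Quotient.field _
  let _ : Fintype (integers K ⧸ Ideal.span {π}) := Fintype.ofFinite _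
  rw [Nat.card_eq_fintype_card] at hq
  have hchar : CharP (integers K ⧸ Ideal.span {π}) p := by
    have hp0 : (p : integers K ⧸ Ideal.span {π}) = 0 := by
      rw [← map_natCast (Ideal.Quotient.mk (Ideal.span {π})), Ideal.Quotient.eq_zero_iff_mem,
        Ideal.mem_span_singleton]
      exact uniformizer_dvd hπ (by simpa using hpK)
    exact (CharP.charP_iff_prime_eq_zero hp.out).mpr hp0
  obtain ⟨r, -, hr⟩ := FiniteField.card (integers K ⧸ Ideal.span {π}) p
  refine ⟨⟨hπ.ne_zero, ?_, ?_, ⟨p, r, hp.out, hchar, hq.trans hr⟩, ?_⟩, r, r.ne_zero, hq.trans hr⟩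
  · intro m hm
    rw [isUnit_integers_iff]
    show ‖1 - (π : K) ^ m‖ = 1
    have hlt : ‖(π : K) ^ m‖ < 1 := by
      rw [norm_pow]
      exact pow_lt_one₀ (norm_nonneg _) (norm_uniformizer_lt_one hπ) hm
    rw [sub_eq_add_neg, IsUltrametricDist.norm_add_eq_max_of_norm_ne_norm, norm_neg, norm_one,
      max_eq_left hlt.le]
    rw [norm_neg, norm_one]
    exact hlt.ne'
  · rw [hq]
    exact Fintype.one_lt_card
  · intro x
    rw [hq]
    exact FiniteField.pow_card x

end Integers

section Roots

variable {K : Type*} [NormedField K] [IsUltrametricDist K] {Ω : Type*} [NormedField Ω]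
  [NormedAlgebra K Ω] [IsUltrametricDist Ω] {π : integers K} (hπ : Irreducible π) {q : ℕ}

lemma norm_aeval_le_one {z : Ω} (hz : ‖z‖ ≤ 1) (P : Polynomial (integers K)) :
    ‖Polynomial.aeval z P‖ ≤ 1 := by
  rw [Polynomial.aeval_eq_sum_range]
  refine IsUltrametricDist.norm_sum_le_of_forall_le_of_nonneg zero_le_one fun i _ => ?_
  rw [Algebra.smul_def, norm_mul, norm_algebraMap_integers, norm_pow]
  exact mul_le_one₀ (norm_integers_le_one _) (by positivity) (pow_le_one₀ (norm_nonneg _) hz)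

lemma norm_aeval_eq_one {z : Ω} (hz : ‖z‖ < 1) {P : Polynomial (integers K)}
    (hP : P.coeff 0 = 1) : ‖Polynomial.aeval z P‖ = 1 := by
  have h1 : ‖Polynomial.aeval z P.divX * z‖ < 1 := by
    rw [norm_mul]
    exact mul_lt_one_of_nonneg_of_lt_one_right (norm_aeval_le_one hz.le _) (norm_nonneg _) hz
  rw [← Polynomial.divX_mul_X_add P, hP, map_one, map_add, map_mul, Polynomial.aeval_X, map_one,
    IsUltrametricDist.norm_add_eq_max_of_norm_ne_norm (by rw [norm_one]; exact h1.ne), norm_one,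
    max_eq_right h1.le]

lemma dvd_coeff_of_mem_polySet {g : Polynomial (integers K)} (hg : g ∈ polySet π q) {n : ℕ}
    (hn : n ≠ q) : π ∣ g.coeff n := by
  obtain ⟨h, hh⟩ := hg.2.2.2
  have := congrArg (PowerSeries.coeff n) hh
  rw [map_sub, Polynomial.coeff_coe, PowerSeries.coeff_X_pow, if_neg hn, sub_zero,
    PowerSeries.coeff_C_mul] at this
  exact ⟨_, this⟩

include hπ

lemma norm_lt_one_of_aeval_eq_zero {g : Polynomial (integers K)} (hg : g ∈ polySet π q)
    {z : Ω} (hz : Polynomial.aeval z g = 0) : ‖z‖ < 1 := by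
  by_contra! h1
  rw [Polynomial.aeval_eq_sum_range, hg.2.1, Finset.sum_range_succ] at hz
  have hlead : g.coeff q = 1 := hg.2.1 ▸ hg.1
  rw [hlead, one_smul] at hz
  have hle : ‖∑ i ∈ Finset.range q, g.coeff i • z ^ i‖ ≤ ‖(π : K)‖ * ‖z‖ ^ q := by
    refine IsUltrametricDist.norm_sum_le_of_forall_le_of_nonneg (by positivity) fun i hi => ?_
    rw [Finset.mem_range] at hi
    obtain ⟨c, hc⟩ := dvd_coeff_of_mem_polySet hg hi.ne
    rw [hc, Algebra.smul_def, norm_mul, norm_algebraMap_integers, norm_pow]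
    refine mul_le_mul ?_ (pow_le_pow_right₀ h1 hi.le) (by positivity) (norm_nonneg _)
    show ‖(π : K) * c‖ ≤ _
    rw [norm_mul]
    exact mul_le_of_le_one_right (norm_nonneg _) (norm_integers_le_one c)
  have hz' : ‖z‖ ^ q ≤ ‖(π : K)‖ * ‖z‖ ^ q := by
    refine le_trans (le_of_eq ?_) hle
    rw [← norm_pow, eq_neg_of_add_eq_zero_left hz, norm_neg]
  have := norm_uniformizer_lt_one hπ
  have hpos : 0 < ‖z‖ ^ q := by positivity
  nlinarith

/-- The zeros of `g` in the unit disc are simple: all coefficients of `g'` are divisible by `π`, and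
the constant one is `π`. -/
lemma aeval_derivative_ne_zero (hb : IsFrobeniusBase π q) {g : Polynomial (integers K)}
    (hg : g ∈ polySet π q) {z : Ω} (hz : ‖z‖ < 1) :
    Polynomial.aeval z (Polynomial.derivative g) ≠ 0 := by
  have hq : π ∣ (q : integers K) := by
    rw [← Ideal.mem_span_singleton, ← Ideal.Quotient.eq_zero_iff_mem, map_natCast]
    obtain ⟨p, r, hp, hchar, rfl⟩ := hb.exists_prime_pow
    have hr : r ≠ 0 := by
      rintro rfl
      exact absurd hb.one_lt (by simp)
    rw [Nat.cast_pow, CharP.cast_eq_zero, zero_pow hr]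
  have hdvd : Polynomial.C π ∣ Polynomial.derivative g := by
    rw [Polynomial.C_dvd_iff_dvd_coeff]
    intro n
    rw [Polynomial.coeff_derivative]
    by_cases hn : n + 1 = q
    · refine Dvd.dvd.mul_left ?_ _
      rw [← hn] at hq
      exact_mod_cast hq
    · exact Dvd.dvd.mul_right (dvd_coeff_of_mem_polySet hg hn) _
  obtain ⟨D, hD⟩ := hdvd
  have hD0 : D.coeff 0 = 1 := by
    have h1 := congrArg (fun P => Polynomial.coeff P 0) hD
    simp only [Polynomial.coeff_derivative, Polynomial.coeff_C_mul] at h1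
    have h2 : g.coeff 1 = π := by
      rw [← Polynomial.coeff_coe]
      exact hg.2.2.coeff_one
    rw [zero_add, h2, Nat.cast_zero, zero_add, mul_one] at h1
    exact (mul_left_cancel₀ hπ.ne_zero (h1.symm.trans (mul_one π).symm))
  rw [hD, map_mul, Polynomial.aeval_C]
  refine mul_ne_zero ?_ ?_
  · rw [← norm_pos_iff, norm_algebraMap_integers]
    exact norm_uniformizer_pos hπ
  · rw [← norm_ne_zero_iff, norm_aeval_eq_one hz hD0]
    exact one_ne_zero

variable [CompleteSpace K] [Algebra.IsAlgebraic K Ω]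

/-- The condition `‖z‖ < 1` is automatic for zeros of the polynomial `g`. -/
lemma torsion_zero_eq {g : Polynomial (integers K)} (hg : g ∈ polySet π q) :
    torsion Ω (g : (integers K)⟦X⟧) 0 = {z : Ω | Polynomial.aeval z g = 0} := by
  ext z
  refine ⟨fun h => ?_, fun h => ?_⟩
  · have := h.2
    rwa [zero_add, Function.iterate_one, evalSeries_polynomial (exists_one_lt_norm hπ) h.1] at this
  · have hz := norm_lt_one_of_aeval_eq_zero hπ hg h
    refine ⟨hz, ?_⟩
    rwa [zero_add, Function.iterate_one, evalSeries_polynomial (exists_one_lt_norm hπ) hz]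

open scoped Classical in
lemma torsion_zero_eq_roots {g : Polynomial (integers K)} (hg : g ∈ polySet π q) :
    torsion Ω (g : (integers K)⟦X⟧) 0 =
      ((g.map (algebraMap (integers K) Ω)).roots.toFinset : Set Ω) := by
  rw [torsion_zero_eq hπ hg]
  ext z
  rw [Finset.mem_coe, Multiset.mem_toFinset, Polynomial.mem_roots (hg.1.map _).ne_zero,
    Polynomial.IsRoot, Polynomial.eval_map_algebraMap]
  rfl

lemma finite_torsion_zero {g : Polynomial (integers K)} (hg : g ∈ polySet π q) :
    (torsion Ω (g : (integers K)⟦X⟧) 0).Finite := by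
  rw [torsion_zero_eq_roots hπ hg]
  exact Finset.finite_toSet _

/-- A polynomial in `R(π, q)` has `q` distinct zeros, all in the open unit disc. -/
lemma card_torsion_zero [IsAlgClosed Ω] (hb : IsFrobeniusBase π q) {g : Polynomial (integers K)}
    (hg : g ∈ polySet π q) : Nat.card (torsion Ω (g : (integers K)⟦X⟧) 0) = q := by
  classical
  set P := g.map (algebraMap (integers K) Ω) with hP
  have hP0 : P ≠ 0 := (hg.1.map _).ne_zero
  have hnodup : P.roots.Nodup := by
    rw [Multiset.nodup_iff_count_le_one]
    intro z
    rw [Polynomial.count_roots]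
    by_contra! h
    rw [Polynomial.one_lt_rootMultiplicity_iff_isRoot hP0] at h
    obtain ⟨h0, h1⟩ := h
    rw [Polynomial.IsRoot, hP, Polynomial.eval_map_algebraMap] at h0
    rw [Polynomial.IsRoot, hP, Polynomial.derivative_map, Polynomial.eval_map_algebraMap] at h1
    exact aeval_derivative_ne_zero hπ hb hg (norm_lt_one_of_aeval_eq_zero hπ hg h0) h1
  rw [torsion_zero_eq_roots hπ hg, Nat.card_eq_card_toFinset]
  simp only [Finset.toFinset_coe]
  rw [Multiset.toFinset_card_of_nodup hnodup, ← (IsAlgClosed.splits P).natDegree_eq_card_roots, hP,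
    hg.1.natDegree_map, hg.2.1]

end Roots

/-! ### Factorization of `g(Y) - g(s)` and the product formula -/

/-- The sign `(-1) ^ (q + 1)` for `q = p ^ r` is `-1` if `p = 2` and `1` otherwise. -/
lemma neg_one_pow_prime_pow_succ {B : Type*} [CommRing B] {p : ℕ} (hp : p.Prime) {r : ℕ}
    (hr : r ≠ 0) : (-1 : B) ^ (p ^ r + 1) = (-1) ^ (p - 1) := by
  rcases hp.eq_two_or_odd' with rfl | ho
  · rw [pow_succ, Even.neg_one_pow ((even_two).pow_of_ne_zero hr), one_mul]
    norm_num
  · rw [Even.neg_one_pow (ho.pow).add_one, Even.neg_one_pow (Nat.Odd.sub_odd ho odd_one)]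

section Factorization

variable {R : Type*} [CommRing R] {U : Type*} [CommRing U] [IsDomain U] [Algebra R U]
  [UniformSpace U] [IsUniformAddGroup U] [IsTopologicalRing U] [IsLinearTopology U U] [T2Space U]
  [CompleteSpace U] {g : Polynomial R} {G : FormalGroup R} {ι : Type*} [Fintype ι] {z : ι → U}

omit [IsDomain U] [IsUniformAddGroup U] [IsTopologicalRing U] [T2Space U] [CompleteSpace U] in
lemma isTopologicallyNilpotent_of_constantCoeff {a : U⟦X⟧}
    (ha : IsTopologicallyNilpotent (PowerSeries.constantCoeff a)) : IsTopologicallyNilpotent a :=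
  MvPowerSeries.LinearTopology.isTopologicallyNilpotent_of_constantCoeff ha

omit [IsDomain U] [UniformSpace U] [IsUniformAddGroup U] [IsTopologicalRing U]
  [IsLinearTopology U U] [T2Space U] [CompleteSpace U] in
lemma algebraMap_powerSeries_eq :
    algebraMap R U⟦X⟧ = (PowerSeries.C).comp (algebraMap R U) :=
  RingHom.ext fun _ => PowerSeries.algebraMap_apply

/-- For a series `a` without constant term, the zeros of the polynomial `g(Y) - g(a)` are the
series `a ⊕ z`, where `z` runs through the zeros of `g`; they are distinct since their constant
terms `z` are. -/
theorem map_sub_C_eq_prod (hg : g.Monic) (hdeg : g.natDegree = Fintype.card ι)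
    (h0 : g.natDegree ≠ 0) (hG : IsLubinTateLaw (g : R⟦X⟧) G) (hz : Function.Injective z)
    (hz0 : ∀ i, Polynomial.aeval (z i) g = 0) (hzn : ∀ i, IsTopologicallyNilpotent (z i))
    {a : U⟦X⟧} (ha : PowerSeries.constantCoeff a = 0) :
    g.map (algebraMap R U⟦X⟧) - Polynomial.C (Polynomial.aeval a g) =
      ∏ i, (Polynomial.X - Polynomial.C (lawSum G a (PowerSeries.C (z i)))) := by
  have ha' : IsTopologicallyNilpotent a :=
    isTopologicallyNilpotent_of_constantCoeff (by rw [ha]; exact IsTopologicallyNilpotent.zero)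
  have hCn : ∀ i, IsTopologicallyNilpotent (PowerSeries.C (z i) : U⟦X⟧) := fun i =>
    isTopologicallyNilpotent_of_constantCoeff (by
      rw [PowerSeries.constantCoeff_C]
      exact hzn i)
  have hmonic : (g.map (algebraMap R U⟦X⟧)).Monic := hg.map _
  have hdeg' : (g.map (algebraMap R U⟦X⟧)).natDegree = g.natDegree := hg.natDegree_map _
  refine eq_prod_X_sub_C_of_injective ?_ ?_ ?_ ?_
  · refine hmonic.sub_of_left (Polynomial.degree_C_le.trans_lt ?_)
    rw [Polynomial.degree_eq_natDegree hmonic.ne_zero, hdeg']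
    exact_mod_cast Nat.pos_of_ne_zero h0
  · intro i j hij
    have hconst : ∀ i, PowerSeries.constantCoeff
        (lawSum G a (PowerSeries.C (z i))) = z i := fun i => by
      rw [map_lawSum (PowerSeries.WithPiTopology.continuous_constantCoeff _) (fun c => by
        rw [algebraMap_powerSeries_eq, RingHom.comp_apply, PowerSeries.constantCoeff_C]) ha'
        (hCn i), ha, PowerSeries.constantCoeff_C, zero_lawSum (hzn i)]
    have := congrArg PowerSeries.constantCoeff hij
    simp only [hconst] at this
    exact hz this
  · intro i
    have h2 : evalOne (PowerSeries.C (z i) : U⟦X⟧) (g : R⟦X⟧) = 0 := by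
      rw [evalOne_polynomial, Polynomial.aeval_def, algebraMap_powerSeries_eq,
        ← Polynomial.hom_eval₂, ← Polynomial.aeval_def, hz0, map_zero]
    rw [Polynomial.IsRoot, Polynomial.eval_sub, Polynomial.eval_map_algebraMap, Polynomial.eval_C,
      ← evalOne_polynomial, evalOne_lawSum ha' (hCn i) hG.2, h2, lawSum_zero, evalOne_polynomial,
      sub_self]
    exact isTopologicallyNilpotent_evalOne ha' hG.2.1
  · rw [Polynomial.natDegree_sub_C, hdeg', hdeg]

/-- The constant terms in the factorization of `g(Y) - g(a)`. -/
theorem prod_lawSum_C (hg : g.Monic) (hdeg : g.natDegree = Fintype.card ι) (h0 : g.natDegree ≠ 0)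
    (hG : IsLubinTateLaw (g : R⟦X⟧) G) (hz : Function.Injective z)
    (hz0 : ∀ i, Polynomial.aeval (z i) g = 0) (hzn : ∀ i, IsTopologicallyNilpotent (z i))
    {a : U⟦X⟧} (ha : PowerSeries.constantCoeff a = 0) :
    ∏ i, lawSum G a (PowerSeries.C (z i)) =
      (-1) ^ (g.natDegree + 1) * Polynomial.aeval a g := by
  have hg0 : g.coeff 0 = 0 := by
    rw [← Polynomial.coeff_coe, PowerSeries.coeff_zero_eq_constantCoeff_apply, hG.2.1]
  have key := congrArg (Polynomial.eval 0) (map_sub_C_eq_prod hg hdeg h0 hG hz hz0 hzn ha)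
  rw [Polynomial.eval_sub, Polynomial.eval_C, Polynomial.eval_map_algebraMap,
    ← Polynomial.coeff_zero_eq_aeval_zero', hg0, map_zero, zero_sub, Polynomial.eval_prod] at key
  simp only [Polynomial.eval_sub, Polynomial.eval_X, Polynomial.eval_C, zero_sub] at key
  rw [Finset.prod_neg, Finset.card_univ, ← hdeg] at key
  have h1 : ((-1 : U⟦X⟧) ^ g.natDegree) * (-1) ^ g.natDegree = 1 := by
    rw [← mul_pow, neg_one_mul, neg_neg, one_pow]
  rw [pow_succ]
  linear_combination (-(∏ i, lawSum G a (PowerSeries.C (z i)))) * h1 -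
    (-1) ^ g.natDegree * key

/-- The factorization of `g(Y) - g(X)`, specialized to `X = t`, `Y = y`. -/
theorem aeval_sub_aeval_eq_prod (hg : g.Monic) (hdeg : g.natDegree = Fintype.card ι)
    (h0 : g.natDegree ≠ 0) (hG : IsLubinTateLaw (g : R⟦X⟧) G) (hz : Function.Injective z)
    (hz0 : ∀ i, Polynomial.aeval (z i) g = 0) (hzn : ∀ i, IsTopologicallyNilpotent (z i))
    {t : U} (ht : IsTopologicallyNilpotent t) (y : U) :
    Polynomial.aeval y g - Polynomial.aeval t g = ∏ i, (y - lawSum G t (z i)) := by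
  have hX : IsTopologicallyNilpotent (PowerSeries.X : U⟦X⟧) :=
    isTopologicallyNilpotent_of_constantCoeff (by
      rw [PowerSeries.constantCoeff_X]
      exact IsTopologicallyNilpotent.zero)
  have hCn : ∀ i, IsTopologicallyNilpotent (PowerSeries.C (z i) : U⟦X⟧) := fun i =>
    isTopologicallyNilpotent_of_constantCoeff (by
      rw [PowerSeries.constantCoeff_C]
      exact hzn i)
  -- the substitution of `t` for `X`
  obtain ⟨ε, hε, hεC, hεX⟩ : ∃ ε : U⟦X⟧ →+* U, Continuous ε ∧
      (∀ c : U, ε (PowerSeries.C c) = c) ∧ ε PowerSeries.X = t := by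
    refine ⟨(PowerSeries.aeval ht : U⟦X⟧ →ₐ[U] U), PowerSeries.continuous_aeval ht,
      fun c => (PowerSeries.aeval ht : U⟦X⟧ →ₐ[U] U).commutes c, ?_⟩
    rw [← Polynomial.coe_X]
    exact (PowerSeries.aeval_coe ht _).trans (Polynomial.aeval_X t)
  have hεR : ∀ c : R, ε (algebraMap R U⟦X⟧ c) = algebraMap R U c := fun c => by
    rw [algebraMap_powerSeries_eq, RingHom.comp_apply, hεC]
  have hεR' : ε.comp (algebraMap R U⟦X⟧) = algebraMap R U := RingHom.ext hεR
  have key := congrArg (Polynomial.eval₂ ε y)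
    (map_sub_C_eq_prod hg hdeg h0 hG hz hz0 hzn (a := PowerSeries.X) PowerSeries.constantCoeff_X)
  simp only [Polynomial.eval₂_sub, Polynomial.eval₂_map, Polynomial.eval₂_C,
    Polynomial.eval₂_finsetProd, Polynomial.eval₂_X, hεR'] at key
  have h1 : ε (Polynomial.aeval PowerSeries.X g) = Polynomial.aeval t g := by
    rw [Polynomial.aeval_def, Polynomial.hom_eval₂, hεR', hεX, Polynomial.aeval_def]
  have h2 : ∀ i, ε (lawSum G PowerSeries.X (PowerSeries.C (z i))) = lawSum G t (z i) := fun i => by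
    rw [map_lawSum hε hεR hX (hCn i), hεX, hεC]
  simp_rw [h1, h2] at key
  exact key

end Factorization

section Coefficientwise

variable {K : Type*} [NormedField K] [IsUltrametricDist K] {Ω : Type*} [NormedField Ω]
  [NormedAlgebra K Ω] {U : Type*} [CommRing U] [Algebra (integers K) U]
  [UniformSpace U] [IsUniformAddGroup U] [IsTopologicalRing U] [IsLinearTopology U U] [T2Space U]
  [CompleteSpace U] {φ : U →+* Ω}

omit [IsUniformAddGroup U] [IsTopologicalRing U] [IsLinearTopology U U] [T2Space U]
  [CompleteSpace U] [UniformSpace U] in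
lemma map_algebraMap_powerSeries
    (hc : ∀ c : integers K, φ (algebraMap (integers K) U c) = algebraMap K Ω c) (c : integers K) :
    PowerSeries.map φ (algebraMap (integers K) U⟦X⟧ c) =
      algebraMap K Ω⟦X⟧ (algebraMap (integers K) K c) := by
  rw [algebraMap_powerSeries_eq, RingHom.comp_apply, PowerSeries.map_C,
    PowerSeries.algebraMap_apply, hc]
  rfl

omit [IsUniformAddGroup U] [IsTopologicalRing U] [IsLinearTopology U U] [T2Space U]
  [CompleteSpace U] in
lemma continuous_powerSeries_map (hφ : Continuous φ) : Continuous (PowerSeries.map φ) :=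
  continuous_pi fun d => hφ.comp (continuous_apply d)

/-- Values of a formal group law at power series over `Ω` whose coefficients lie in a complete
ring `U` can be computed over `U`. -/
lemma evalLaw_powerSeries_map (hφ : Continuous φ)
    (hc : ∀ c : integers K, φ (algebraMap (integers K) U c) = algebraMap K Ω c)
    {a b : U⟦X⟧} (ha : IsTopologicallyNilpotent a) (hb : IsTopologicallyNilpotent b)
    (F : FormalGroup (integers K)) :
    evalLaw F (PowerSeries.map φ a) (PowerSeries.map φ b) = PowerSeries.map φ (lawSum F a b) :=
  evalLaw_map (continuous_powerSeries_map hφ) (map_algebraMap_powerSeries hc) ha hb F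

lemma evalSeries_powerSeries_map (hφ : Continuous φ)
    (hc : ∀ c : integers K, φ (algebraMap (integers K) U c) = algebraMap K Ω c)
    {a : U⟦X⟧} (ha : IsTopologicallyNilpotent a) (h : (integers K)⟦X⟧) :
    evalSeries h (PowerSeries.map φ a) = PowerSeries.map φ (evalOne a h) :=
  evalSeries_map (continuous_powerSeries_map hφ) (map_algebraMap_powerSeries hc) ha h

end Coefficientwise

section Products

variable {K : Type*} [NormedField K] [IsUltrametricDist K] [CompleteSpace K] {Ω : Type*}
  [NormedField Ω] [NormedAlgebra K Ω] [IsUltrametricDist Ω] [Algebra.IsAlgebraic K Ω]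
  {π : integers K} (hπ : Irreducible π) {q : ℕ} (hb : IsFrobeniusBase π q)
  [IsAlgClosed Ω] {g : Polynomial (integers K)} (hg : g ∈ polySet π q)
  {G : FormalGroup (integers K)} (hG : IsLubinTateLaw (g : (integers K)⟦X⟧) G)

include hπ hb hg

/-- The zeros of `g` as elements of the ring of integers of a finite extension containing a given
finite set. -/
lemma exists_torsionPoints {s : Set Ω} (hs : s.Finite) :
    ∃ L : IntermediateField K Ω, FiniteDimensional K L ∧ s ⊆ L ∧ CompleteSpace (unitBall L) ∧
      ∃ (_ : Fintype (torsion Ω (g : (integers K)⟦X⟧) 0))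
        (z : torsion Ω (g : (integers K)⟦X⟧) 0 → unitBall L),
        g.natDegree = Fintype.card (torsion Ω (g : (integers K)⟦X⟧) 0) ∧ (∀ i, (z i : Ω) = i) ∧
        Function.Injective z ∧ (∀ i, Polynomial.aeval (z i) g = 0) ∧
        ∀ i, IsTopologicallyNilpotent (z i) := by
  have hfin := finite_torsion_zero (Ω := Ω) hπ hg
  obtain ⟨L, hfd, hL⟩ := exists_mem_finiteDimensional (K := K) _ (hs.union hfin)
  let hft := hfin.fintype
  refine ⟨L, hfd, Set.subset_union_left.trans hL,
    completeSpace_unitBall (L := L) (exists_one_lt_norm hπ), hft,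
    fun i => ⟨i, hL (Or.inr i.2), i.2.1.le⟩, ?_, fun _ => rfl, fun i j hij => ?_, fun i => ?_,
    fun i => isTopologicallyNilpotent_unitBall_iff.mpr i.2.1⟩
  · rw [hg.2.1, ← card_torsion_zero (Ω := Ω) hπ hb hg, Nat.card_eq_fintype_card]
  · exact Subtype.ext (congrArg (fun x : unitBall L => (x : Ω)) hij)
  · have h1 : Polynomial.aeval (i : Ω) g = 0 := (torsion_zero_eq (Ω := Ω) hπ hg).subset i.2
    apply Subtype.ext
    refine Eq.trans ?_ h1
    exact (Polynomial.aeval_algHom_apply (unitBall L).val _ g).symm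

include hG

/-- Two points of the open unit disc with the same image under `g` differ by a zero of `g`. -/
theorem exists_eq_evalLaw_of_aeval_eq {t y : Ω} (ht : ‖t‖ < 1) (hy : ‖y‖ < 1)
    (h : Polynomial.aeval y g = Polynomial.aeval t g) :
    ∃ z ∈ torsion Ω (g : (integers K)⟦X⟧) 0, y = evalLaw G t z := by
  obtain ⟨L, _, hL, _, _, z, hcard, hzval, hzi, hz0, hzn⟩ :=
    exists_torsionPoints (Ω := Ω) hπ hb hg (s := {t, y}) (by simp)
  set t' : unitBall L := ⟨t, hL (by simp), ht.le⟩ with ht'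
  set y' : unitBall L := ⟨y, hL (by simp), hy.le⟩ with hy'
  have key := aeval_sub_aeval_eq_prod hg.1 hcard (hg.2.1 ▸ (zero_lt_one.trans hb.one_lt).ne') hG
    hzi hz0 hzn (t := t') (isTopologicallyNilpotent_unitBall_iff.mpr ht) y'
  have h2 : Polynomial.aeval y' g = Polynomial.aeval t' g := by
    apply Subtype.ext
    have e1 := Polynomial.aeval_algHom_apply (unitBall L).val y' g
    have e2 := Polynomial.aeval_algHom_apply (unitBall L).val t' g
    exact e1.symm.trans (h.trans e2)
  rw [h2, sub_self, eq_comm, Finset.prod_eq_zero_iff] at key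
  obtain ⟨i, -, hi⟩ := key
  refine ⟨i, i.2, ?_⟩
  have h3 := congrArg (fun x : unitBall L => (x : Ω)) (sub_eq_zero.mp hi)
  refine h3.trans ?_
  rw [← hzval i]
  exact (evalLaw_coe (exists_one_lt_norm hπ) t' (z i) ht (by rw [hzval]; exact i.2.1) G).symm

omit hπ hb hg hG [CompleteSpace K] [Algebra.IsAlgebraic K Ω] [IsAlgClosed Ω] in
lemma map_val_map_algebraMap {L : IntermediateField K Ω} (s : (integers K)⟦X⟧) :
    PowerSeries.map ((unitBall L).val : unitBall L →+* Ω)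
      (PowerSeries.map (algebraMap (integers K) (unitBall L)) s) = toSeries Ω s := by
  ext n
  rfl

omit hπ hb hg hG [CompleteSpace K] [Algebra.IsAlgebraic K Ω] [IsAlgClosed Ω] in
lemma map_val_C {L : IntermediateField K Ω} {c : unitBall L} {x : Ω} (hx : (c : Ω) = x) :
    PowerSeries.map ((unitBall L).val : unitBall L →+* Ω) (PowerSeries.C c) = PowerSeries.C x := by
  rw [PowerSeries.map_C, ← hx]
  rfl

/-- The product formula for `s(x) ⊕ z`, up to the form of the sign: compare the constant terms in
the factorization of `g(Y) - g(s)`. -/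
theorem finprod_evalLaw_toSeries {s : (integers K)⟦X⟧} (hs : PowerSeries.constantCoeff s = 0) :
    ∏ᶠ z ∈ torsion Ω (g : (integers K)⟦X⟧) 0, evalLaw G (toSeries Ω s) (PowerSeries.C z : Ω⟦X⟧) =
      (-1) ^ (q + 1) * toSeries Ω (Polynomial.aeval s g) := by
  obtain ⟨L, _, -, _, _, z, hcard, hzval, hzi, hz0, hzn⟩ :=
    exists_torsionPoints (Ω := Ω) hπ hb hg Set.finite_empty
  set a : (unitBall L)⟦X⟧ := PowerSeries.map (algebraMap (integers K) (unitBall L)) s with ha_def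
  have ha : PowerSeries.constantCoeff a = 0 := by
    rw [ha_def, ← PowerSeries.coeff_zero_eq_constantCoeff_apply, PowerSeries.coeff_map,
      PowerSeries.coeff_zero_eq_constantCoeff_apply, hs, map_zero]
  have ha' : IsTopologicallyNilpotent a :=
    isTopologicallyNilpotent_of_constantCoeff (by rw [ha]; exact IsTopologicallyNilpotent.zero)
  have hterm : ∀ i : torsion Ω (g : (integers K)⟦X⟧) 0,
      evalLaw G (toSeries Ω s) (PowerSeries.C (i : Ω) : Ω⟦X⟧) =
        PowerSeries.map ((unitBall L).val : unitBall L →+* Ω)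
          (lawSum G a (PowerSeries.C (z i))) := fun i => by
    rw [← evalLaw_powerSeries_map (φ := ((unitBall L).val : unitBall L →+* Ω))
      continuous_unitBall_val (fun _ => rfl) ha'
      (isTopologicallyNilpotent_of_constantCoeff (by
        rw [PowerSeries.constantCoeff_C]
        exact hzn i)) G, map_val_C (hzval i), ha_def, map_val_map_algebraMap]
  have hφg : PowerSeries.map ((unitBall L).val : unitBall L →+* Ω) (Polynomial.aeval a g) =
        toSeries Ω (Polynomial.aeval s g) := by
    rw [← map_val_map_algebraMap (L := L), Polynomial.aeval_def, Polynomial.aeval_def,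
      Polynomial.hom_eval₂ _ _ (PowerSeries.map (algebraMap (integers K) (unitBall L)))]
    congr 2
  rw [← finprod_set_coe_eq_finprod_mem, finprod_eq_prod_of_fintype]
  simp_rw [hterm]
  rw [← map_prod, prod_lawSum_C hg.1 hcard (hg.2.1 ▸ (zero_lt_one.trans hb.one_lt).ne') hG hzi hz0
    hzn ha, map_mul, hφg, map_pow, map_neg, map_one, hg.2.1]

end Products

/-! ### Transport along an isomorphism -/

section Transport

variable {R : Type*} [CommRing R] {U : Type*} [CommRing U] [Algebra R U]
  [UniformSpace U] [IsUniformAddGroup U] [IsTopologicalRing U] [IsLinearTopology U U] [T2Space U]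
  [CompleteSpace U]

lemma evalOne_powerSeries_X (h : R⟦X⟧) :
    evalOne (PowerSeries.X : U⟦X⟧) h = PowerSeries.map (algebraMap R U) h := by
  have hX : IsTopologicallyNilpotent (PowerSeries.X : U⟦X⟧) :=
    isTopologicallyNilpotent_of_constantCoeff (by
      rw [PowerSeries.constantCoeff_X]
      exact IsTopologicallyNilpotent.zero)
  refine (hasSum_evalOne hX h).unique ?_
  have h1 : ∀ n, algebraMap R U⟦X⟧ (PowerSeries.coeff n h) * PowerSeries.X ^ n =
      PowerSeries.monomial n (PowerSeries.coeff n (PowerSeries.map (algebraMap R U) h)) :=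
    fun n => by
      rw [algebraMap_powerSeries_eq, RingHom.comp_apply, PowerSeries.monomial_eq_C_mul_X_pow,
        PowerSeries.coeff_map]
  simp_rw [h1]
  exact PowerSeries.hasSum_of_monomials_self _

lemma evalOne_powerSeries_C {v : U} (hv : IsTopologicallyNilpotent v) (h : R⟦X⟧) :
    evalOne (PowerSeries.C v : U⟦X⟧) h = PowerSeries.C (evalOne v h) :=
  (map_evalOne PowerSeries.WithPiTopology.continuous_C (fun c => by
    rw [algebraMap_powerSeries_eq, RingHom.comp_apply]) hv h).symm

end Transport

section Coefficientwise

variable {K : Type*} [NormedField K] [IsUltrametricDist K] {Ω : Type*} [NormedField Ω]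
  [NormedAlgebra K Ω] {U : Type*} [CommRing U] [Algebra (integers K) U]
  [UniformSpace U] [IsUniformAddGroup U] [IsTopologicalRing U] [IsLinearTopology U U] [T2Space U]
  [CompleteSpace U] {φ : U →+* Ω}

/-- The identity `h(x ⊕ v) = h(x) ⊕ h(v)` for a homomorphism `h`, as an identity of power series
over `Ω`, at a point `v` that lies in a complete subring. -/
lemma evalSeries_evalLaw_X_C (hφ : Continuous φ)
    (hc : ∀ c : integers K, φ (algebraMap (integers K) U c) = algebraMap K Ω c)
    {v : U} (hv : IsTopologicallyNilpotent v) {F G : FormalGroup (integers K)}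
    {h : (integers K)⟦X⟧} (hh : IsFormalHom F G h) :
    evalSeries h (evalLaw F (PowerSeries.X : Ω⟦X⟧) (PowerSeries.C (φ v))) =
      evalLaw G (toSeries Ω h) (PowerSeries.C (φ (evalOne v h)) : Ω⟦X⟧) := by
  have hX : IsTopologicallyNilpotent (PowerSeries.X : U⟦X⟧) :=
    isTopologicallyNilpotent_of_constantCoeff (by
      rw [PowerSeries.constantCoeff_X]
      exact IsTopologicallyNilpotent.zero)
  have hC : ∀ {w : U}, IsTopologicallyNilpotent w →
      IsTopologicallyNilpotent (PowerSeries.C w : U⟦X⟧) := fun hw =>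
    isTopologicallyNilpotent_of_constantCoeff (by
      rw [PowerSeries.constantCoeff_C]
      exact hw)
  have h1 : toSeries Ω h = PowerSeries.map φ (PowerSeries.map (algebraMap (integers K) U) h) := by
    ext n
    exact (hc _).symm
  rw [h1, ← PowerSeries.map_X φ, ← PowerSeries.map_C φ, ← PowerSeries.map_C φ,
    evalLaw_powerSeries_map hφ hc hX (hC hv),
    evalSeries_powerSeries_map hφ hc (isTopologicallyNilpotent_lawSum hX (hC hv) F),
    evalOne_lawSum hX (hC hv) hh, evalOne_powerSeries_X, evalOne_powerSeries_C hv,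
    evalLaw_powerSeries_map hφ hc ?_ (hC (isTopologicallyNilpotent_evalOne hv hh.1))]
  rw [← evalOne_powerSeries_X]
  exact isTopologicallyNilpotent_evalOne hX hh.1

end Coefficientwise

section Torsion

variable {K : Type*} [NormedField K] [IsUltrametricDist K] [CompleteSpace K] {Ω : Type*}
  [NormedField Ω] [NormedAlgebra K Ω] [IsUltrametricDist Ω] [Algebra.IsAlgebraic K Ω]
  (hK : ∃ x : K, 1 < ‖x‖)

include hK

omit [Algebra.IsAlgebraic K Ω] [CompleteSpace K] [IsUltrametricDist Ω] hK in
lemma evalSeries_zero {h : (integers K)⟦X⟧} (h0 : PowerSeries.constantCoeff h = 0) :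
    evalSeries h (0 : Ω) = 0 := by
  rw [evalSeries, tsum_eq_single 0]
  · rw [PowerSeries.coeff_zero_eq_constantCoeff_apply, h0, map_zero, map_zero, zero_mul]
  · intro n hn
    rw [zero_pow hn, mul_zero]

lemma norm_iterate_evalSeries_lt_one {f : (integers K)⟦X⟧}
    (hf : PowerSeries.constantCoeff f = 0) {x : Ω} (hx : ‖x‖ < 1) (n : ℕ) :
    ‖(evalSeries f)^[n] x‖ < 1 := by
  induction n with
  | zero => exact hx
  | succ n ih =>
    rw [Function.iterate_succ_apply']
    exact norm_evalSeries_lt_one hK ih hf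

/-- If `g ∘ r = r ∘ f`, the same holds for the iterates of `f` and `g`, at points of the disc. -/
lemma iterate_evalSeries_comm {f g r : (integers K)⟦X⟧}
    (hf : PowerSeries.constantCoeff f = 0) (hr : PowerSeries.constantCoeff r = 0)
    (h : PowerSeries.subst r g = PowerSeries.subst f r) {x : Ω} (hx : ‖x‖ < 1) (n : ℕ) :
    (evalSeries g)^[n] (evalSeries r x) = evalSeries r ((evalSeries f)^[n] x) := by
  induction n with
  | zero => rfl
  | succ n ih =>
    have hn := norm_iterate_evalSeries_lt_one hK hf hx n
    rw [Function.iterate_succ_apply', ih, Function.iterate_succ_apply', ← evalSeries_subst hK hn hr,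
      h, evalSeries_subst hK hn hf]

/-- An isomorphism `r` with `g ∘ r = r ∘ f` maps the torsion points of `f` bijectively to those of
`g`. -/
lemma bijOn_torsion {f g r k : (integers K)⟦X⟧}
    (hf : PowerSeries.constantCoeff f = 0)
    (hr : PowerSeries.constantCoeff r = 0) (hk : PowerSeries.constantCoeff k = 0)
    (h : PowerSeries.subst r g = PowerSeries.subst f r)
    (hkr : PowerSeries.subst r k = PowerSeries.X) (hrk : PowerSeries.subst k r = PowerSeries.X)
    (n : ℕ) : Set.BijOn (evalSeries r : Ω → Ω) (torsion Ω f n) (torsion Ω g n) := by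
  have hkr' : ∀ x : Ω, ‖x‖ < 1 → evalSeries k (evalSeries r x) = x := fun x hx => by
    rw [← evalSeries_subst hK hx hr, hkr, evalSeries_X hK hx]
  have hrk' : ∀ x : Ω, ‖x‖ < 1 → evalSeries r (evalSeries k x) = x := fun x hx => by
    rw [← evalSeries_subst hK hx hk, hrk, evalSeries_X hK hx]
  refine ⟨fun x hx => ⟨norm_evalSeries_lt_one hK hx.1 hr, ?_⟩, fun x hx y hy hxy => ?_,
    fun y hy => ?_⟩
  · rw [iterate_evalSeries_comm hK hf hr h hx.1, hx.2, evalSeries_zero hr]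
  · rw [← hkr' x hx.1, hxy, hkr' y hy.1]
  · have hx := norm_evalSeries_lt_one hK hy.1 hk
    refine ⟨evalSeries k y, ⟨hx, ?_⟩, hrk' y hy.1⟩
    have h1 := iterate_evalSeries_comm hK hf hr h hx (n + 1)
    rw [hrk' y hy.1, hy.2] at h1
    rw [← hkr' _ (norm_iterate_evalSeries_lt_one hK hf hx (n + 1)), ← h1, evalSeries_zero hk]

end Torsion

section SecondProduct

variable {K : Type*} [NormedField K] [IsUltrametricDist K] [CompleteSpace K] {Ω : Type*}
  [NormedField Ω] [NormedAlgebra K Ω] [IsUltrametricDist Ω] [Algebra.IsAlgebraic K Ω]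
  {π : integers K} (hπ : Irreducible π) {q : ℕ} (hb : IsFrobeniusBase π q)
  [IsAlgClosed Ω] {g : Polynomial (integers K)} (hg : g ∈ polySet π q)
  {F G : FormalGroup (integers K)} (hG : IsLubinTateLaw (g : (integers K)⟦X⟧) G)

include hπ hb hg hG

/-- The product formula for `r(x ⊕ v)`: since `r(x ⊕ v) = r(x) ⊕ r(v)` and the `r(v)` are the
zeros of `g`, it is the product formula for `s = r`. -/
theorem finprod_evalSeries_evalLaw {f r : (integers K)⟦X⟧}
    (hf : PowerSeries.constantCoeff f = 0) (hr : IsFormalIso F G r)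
    (h : PowerSeries.subst r (g : (integers K)⟦X⟧) = PowerSeries.subst f r) :
    ∏ᶠ v ∈ torsion Ω f 0, evalSeries r (evalLaw F (PowerSeries.X : Ω⟦X⟧) (PowerSeries.C v)) =
      (-1) ^ (q + 1) * toSeries Ω (PowerSeries.subst f r) := by
  have hK := exists_one_lt_norm hπ
  obtain ⟨hrh, k, hkh, hkr, hrk⟩ := hr
  rw [← h, PowerSeries.subst_coe (PowerSeries.HasSubst.of_constantCoeff_zero' hrh.1)]
  refine Eq.trans ?_ (finprod_evalLaw_toSeries (Ω := Ω) hπ hb hg hG hrh.1)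
  refine finprod_mem_eq_of_bijOn (evalSeries r)
    (bijOn_torsion hK hf hrh.1 hkh.1 h hkr hrk 0) fun v hv => ?_
  obtain ⟨L, a, _, _, ha, rfl⟩ := exists_unitBall_eq hK hv.1
  rw [evalSeries_coe hK a hv.1]
  exact evalSeries_evalLaw_X_C (φ := ((unitBall L).val : unitBall L →+* Ω)) continuous_unitBall_val
    (fun _ => rfl) ha hrh

end SecondProduct

/-! ### Norms of division points -/

section Norms

variable {K : Type*} [NormedField K] [IsUltrametricDist K] {Ω : Type*} [NormedField Ω]
  [NormedAlgebra K Ω] [IsUltrametricDist Ω] {π : integers K} (hπ : Irreducible π) {q : ℕ}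

/-- A system of division points `w₀, w₁, …` of a polynomial `g` without constant term: `w₀` is a
nonzero zero of `g` and `g(wₙ₊₁) = wₙ`. -/
structure IsDivisionSequence (g : Polynomial (integers K)) (w : ℕ → Ω) : Prop where
  norm_lt_one : ∀ n, ‖w n‖ < 1
  ne_zero : w 0 ≠ 0
  aeval_zero : Polynomial.aeval (w 0) g = 0
  aeval_succ : ∀ n, Polynomial.aeval (w (n + 1)) g = w n

include hπ

/-- The norm on `K` is discrete, with values the powers of the norm of a uniformizer. -/
lemma exists_norm_eq_zpow {x : K} (hx : x ≠ 0) : ∃ k : ℤ, ‖x‖ = ‖(π : K)‖ ^ k := by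
  have hpos := norm_uniformizer_pos hπ
  obtain ⟨k, hk1, hk2⟩ := exists_mem_Ioc_zpow (norm_pos_iff.mpr hx)
    ((one_lt_inv₀ hpos).mpr (norm_uniformizer_lt_one hπ))
  have hπ0 : (π : K) ≠ 0 := norm_pos_iff.mp hpos
  have hle : ‖x * (π : K) ^ (k + 1)‖ ≤ 1 := by
    rw [norm_mul, norm_zpow]
    calc _ ≤ (‖(π : K)‖⁻¹) ^ (k + 1) * ‖(π : K)‖ ^ (k + 1) := by gcongr
      _ = 1 := by rw [inv_zpow, inv_mul_cancel₀ (zpow_pos hpos _).ne']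
  have hgt : ‖(π : K)‖ < ‖x * (π : K) ^ (k + 1)‖ := by
    rw [norm_mul, norm_zpow]
    calc ‖(π : K)‖ = (‖(π : K)‖⁻¹) ^ k * ‖(π : K)‖ ^ (k + 1) := by
          rw [inv_zpow, zpow_add₀ hpos.ne', zpow_one, inv_mul_cancel_left₀ (zpow_pos hpos _).ne']
      _ < _ := by gcongr
  refine ⟨-(k + 1), ?_⟩
  have h1 : ‖x * (π : K) ^ (k + 1)‖ = 1 := by
    by_contra hne
    obtain ⟨c, hc⟩ := uniformizer_dvd hπ (c := ⟨_, mem_integers_iff.mpr hle⟩)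
      (lt_of_le_of_ne hle hne)
    have hc' : x * (π : K) ^ (k + 1) = π * c := congrArg Subtype.val hc
    rw [hc', norm_mul] at hgt
    exact hgt.not_ge (mul_le_of_le_one_right hpos.le (norm_integers_le_one c))
  rw [norm_mul, norm_zpow] at h1
  rw [zpow_neg]
  exact eq_inv_of_mul_eq_one_left h1

/-- If the norm of `w` is a `d`-th root of `‖π‖`, then the terms of a polynomial in `w` of degree
less than `d` have distinct norms, and so `w` has degree at least `d` over `K`. -/
lemma aeval_ne_zero_of_norm_pow_eq {w : Ω} {d : ℕ} (hw : ‖w‖ ^ d = ‖(π : K)‖)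
    {P : Polynomial K} (hP : P ≠ 0) (hd : P.natDegree < d) : Polynomial.aeval w P ≠ 0 := by
  have hpos := norm_uniformizer_pos hπ
  have hw0 : 0 < ‖w‖ := by
    refine lt_of_le_of_ne (norm_nonneg _) fun h => ?_
    rw [← h, zero_pow (Nat.ne_zero_of_lt hd)] at hw
    exact hpos.ne hw
  have hw1 : ‖w‖ < 1 := by
    by_contra! h
    have := one_le_pow₀ h (n := d)
    rw [hw] at this
    exact this.not_gt (norm_uniformizer_lt_one hπ)
  -- the exponents `d k + i` with `i < d` determine `i`
  have hnorm : ∀ i ∈ P.support, ∃ k : ℤ, ‖algebraMap K Ω (P.coeff i) * w ^ i‖ =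
      ‖w‖ ^ (d * k + i) := fun i hi => by
    obtain ⟨k, hk⟩ := exists_norm_eq_zpow hπ (Polynomial.mem_support_iff.mp hi)
    refine ⟨k, ?_⟩
    rw [norm_mul, norm_algebraMap', hk, norm_pow, ← hw, zpow_add₀ hw0.ne', zpow_mul,
      zpow_natCast, zpow_natCast]
  have hinj : ∀ i ∈ P.support, ∀ j ∈ P.support, ‖algebraMap K Ω (P.coeff i) * w ^ i‖ =
      ‖algebraMap K Ω (P.coeff j) * w ^ j‖ → i = j := fun i hi j hj h => by
    obtain ⟨k, hk⟩ := hnorm i hi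
    obtain ⟨l, hl⟩ := hnorm j hj
    rw [hk, hl] at h
    have h1 : (d : ℤ) * k + i = d * l + j := zpow_right_injective₀ hw0 hw1.ne h
    have hid : i < d := (Polynomial.le_natDegree_of_mem_supp i hi).trans_lt hd
    have hjd : j < d := (Polynomial.le_natDegree_of_mem_supp j hj).trans_lt hd
    have h2 := congrArg (· % (d : ℤ)) h1
    simp only [Int.mul_add_emod_self_left] at h2
    rw [Int.emod_eq_of_lt (by positivity) (by exact_mod_cast hid),
      Int.emod_eq_of_lt (by positivity) (by exact_mod_cast hjd)] at h2
    exact_mod_cast h2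
  obtain ⟨m, hm, hmax⟩ := P.support.exists_max_image
    (fun i => ‖algebraMap K Ω (P.coeff i) * w ^ i‖) (Polynomial.support_nonempty.mpr hP)
  rw [Polynomial.aeval_def, Polynomial.eval₂_eq_sum, Polynomial.sum, ← norm_ne_zero_iff,
    IsNonarchimedean.apply_sum_eq_of_lt (f := (‖·‖ : Ω → ℝ))
      (fun x y => IsUltrametricDist.norm_add_le_max x y) (fun x => (norm_neg x).symm) hm
      fun j hj hjm => lt_of_le_of_ne (hmax j hj) fun h => hjm (hinj j hj m hm h)]
  obtain ⟨k, hk⟩ := hnorm m hm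
  rw [hk]
  exact (zpow_pos hw0 _).ne'

omit hπ in
/-- `g = x ^ q + π x u(x)` with `u(0) = 1`. -/
lemma exists_eq_X_pow_add (hπ : Irreducible π) (hb : IsFrobeniusBase π q)
    {g : Polynomial (integers K)} (hg : g ∈ polySet π q) :
    ∃ u : Polynomial (integers K), u.coeff 0 = 1 ∧
      g = Polynomial.X ^ q + Polynomial.C π * (Polynomial.X * u) := by
  have hq := hb.one_lt
  obtain ⟨D, hD⟩ : Polynomial.C π ∣ g - Polynomial.X ^ q := by
    rw [Polynomial.C_dvd_iff_dvd_coeff]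
    intro n
    rw [Polynomial.coeff_sub, Polynomial.coeff_X_pow]
    split_ifs with hn
    · have hlead : g.coeff q = 1 := hg.2.1 ▸ hg.1
      rw [hn, hlead, sub_self]
      exact dvd_zero _
    · rw [sub_zero]
      exact dvd_coeff_of_mem_polySet hg hn
  have h0 : D.coeff 0 = 0 := by
    have h1 := congrArg (Polynomial.coeff · 0) hD
    have h2 : g.coeff 0 = 0 := by
      rw [← Polynomial.coeff_coe, PowerSeries.coeff_zero_eq_constantCoeff_apply]
      exact hg.2.2.constantCoeff_eq
    simp only [Polynomial.coeff_sub, Polynomial.coeff_X_pow, h2, Polynomial.coeff_C_mul] at h1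
    rw [if_neg (by omega), sub_zero] at h1
    exact (mul_eq_zero.mp h1.symm).resolve_left hπ.ne_zero
  have h1 : D.coeff 1 = 1 := by
    have h1 := congrArg (Polynomial.coeff · 1) hD
    have h2 : g.coeff 1 = π := by
      rw [← Polynomial.coeff_coe]
      exact hg.2.2.coeff_one
    simp only [Polynomial.coeff_sub, Polynomial.coeff_X_pow, h2, Polynomial.coeff_C_mul] at h1
    rw [if_neg (by omega), sub_zero] at h1
    exact mul_left_cancel₀ hπ.ne_zero (h1.symm.trans (mul_one π).symm)
  refine ⟨D.divX, by rw [Polynomial.coeff_divX, h1], ?_⟩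
  have h2 : Polynomial.X * D.divX = D := by
    conv_rhs => rw [← Polynomial.X_mul_divX_add D, h0, map_zero, add_zero]
  rw [h2, ← hD, add_sub_cancel]

lemma norm_aeval_sub_pow (hb : IsFrobeniusBase π q) {g : Polynomial (integers K)}
    (hg : g ∈ polySet π q) {w : Ω} (hw : ‖w‖ < 1) :
    ‖Polynomial.aeval w g - w ^ q‖ = ‖(π : K)‖ * ‖w‖ := by
  obtain ⟨u, hu, hgu⟩ := exists_eq_X_pow_add hπ hb hg
  rw [hgu, map_add, map_pow, Polynomial.aeval_X, add_sub_cancel_left, map_mul, map_mul,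
    Polynomial.aeval_C, Polynomial.aeval_X, norm_mul, norm_mul, norm_aeval_eq_one hw hu, mul_one,
    norm_algebraMap_integers]

/-- The norms of division points. As `g(w) = w ^ q + ε` with `‖ε‖ = ‖π‖ ‖w‖`, the two terms have the
same norm for `w = w₀`, while for `w = wₙ₊₁` the second one is smaller than `‖π‖ ≤ ‖wₙ‖`, so that
`‖wₙ₊₁‖ ^ q = ‖wₙ‖`. -/
lemma IsDivisionSequence.norm_pow_eq (hb : IsFrobeniusBase π q) {g : Polynomial (integers K)}
    (hg : g ∈ polySet π q) {w : ℕ → Ω} (hw : IsDivisionSequence g w) (n : ℕ) :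
    ‖w n‖ ^ ((q - 1) * q ^ n) = ‖(π : K)‖ := by
  have hq := hb.one_lt
  induction n with
  | zero =>
    have h1 := norm_aeval_sub_pow hπ hb hg (hw.norm_lt_one 0)
    rw [hw.aeval_zero, zero_sub, norm_neg, norm_pow] at h1
    have h2 : q = (q - 1) + 1 := by omega
    rw [pow_zero, mul_one]
    rw [h2, pow_succ] at h1
    exact mul_right_cancel₀ (norm_ne_zero_iff.mpr hw.ne_zero) h1
  | succ n ih =>
    have hle : ‖(π : K)‖ ≤ ‖w n‖ := by
      rw [← ih]
      refine pow_le_of_le_one (norm_nonneg _) (hw.norm_lt_one n).le ?_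
      exact mul_ne_zero (by omega) (pow_ne_zero _ (by omega))
    have h1 := norm_aeval_sub_pow hπ hb hg (hw.norm_lt_one (n + 1))
    rw [hw.aeval_succ] at h1
    have h2 : ‖w n - w (n + 1) ^ q‖ < ‖w n‖ := by
      rw [h1]
      refine lt_of_lt_of_le ?_ hle
      exact mul_lt_of_lt_one_right (norm_uniformizer_pos hπ) (hw.norm_lt_one _)
    have h3 : ‖w (n + 1)‖ ^ q = ‖w n‖ := by
      rw [← norm_pow, ← sub_sub_self (w n) (w (n + 1) ^ q), sub_eq_add_neg (w n) (w n - _),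
        IsUltrametricDist.norm_add_eq_max_of_norm_ne_norm (by rw [norm_neg]; exact h2.ne'),
        norm_neg, max_eq_left h2.le]
    rw [pow_succ, mul_comm (q ^ n) q, mul_left_comm, pow_mul, h3, ih]

end Norms

/-! ### Fields generated by division points -/

section Generation

variable {K : Type*} [NormedField K] [IsUltrametricDist K] [CompleteSpace K] {Ω : Type*}
  [NormedField Ω] [NormedAlgebra K Ω] [IsUltrametricDist Ω] [Algebra.IsAlgebraic K Ω]
  {π : integers K} (hπ : Irreducible π) {q : ℕ} (hb : IsFrobeniusBase π q)
  {g : Polynomial (integers K)} (hg : g ∈ polySet π q) {w : ℕ → Ω}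

include hπ hg

/-- The first division point is a value of a series commuting with `g` at every later one. -/
lemma IsDivisionSequence.exists_zero_eq (hw : IsDivisionSequence g w) (n : ℕ) :
    ∃ e : (integers K)⟦X⟧, PowerSeries.constantCoeff e = 0 ∧
      Intertwines (σ := Unit) (g : (integers K)⟦X⟧) g e ∧ w 0 = evalSeries e (w n) := by
  have hK := exists_one_lt_norm hπ
  have hg0 := hg.2.2.constantCoeff_eq
  induction n with
  | zero =>
    refine ⟨PowerSeries.X, PowerSeries.constantCoeff_X, intertwines_iff.mpr ?_,
      (evalSeries_X hK (hw.norm_lt_one 0)).symm⟩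
    rw [PowerSeries.X_subst, PowerSeries.subst_X (PowerSeries.HasSubst.of_constantCoeff_zero' hg0)]
  | succ n ih =>
    obtain ⟨e, he0, he, hev⟩ := ih
    refine ⟨PowerSeries.subst (g : (integers K)⟦X⟧) e, constantCoeff_subst' he0 hg0,
      he.powerSeries_comp hg0 hg0 he0 hg0 (intertwines_iff.mpr rfl), ?_⟩
    rw [evalSeries_subst hK (hw.norm_lt_one _) hg0, evalSeries_polynomial hK (hw.norm_lt_one _),
      hw.aeval_succ, hev]

variable [IsAlgClosed Ω]

include hb

/-- Every zero of `g` is a value `[a](w₀)`: for representatives `a` of the residue classes modulo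
`π` these values are distinct, and there are as many residue classes as zeros. -/
lemma IsDivisionSequence.exists_evalSeries_eq_of_mem_torsion_zero (hw : IsDivisionSequence g w)
    (hq : q = Nat.card (integers K ⧸ Ideal.span {π})) {y : Ω}
    (hy : y ∈ torsion Ω (g : (integers K)⟦X⟧) 0) :
    ∃ h : (integers K)⟦X⟧, PowerSeries.constantCoeff h = 0 ∧
      Intertwines (σ := Unit) (g : (integers K)⟦X⟧) g h ∧ y = evalSeries h (w 0) := by
  have hK := exists_one_lt_norm hπ
  have hg0 := hg.2.2.constantCoeff_eq
  have hw0 := hw.norm_lt_one 0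
  choose h h0 h1 hi using exists_intertwines_coeff_one hb hg.2.2 hg.2.2
  have hmem : ∀ a, evalSeries (h a) (w 0) ∈ torsion Ω (g : (integers K)⟦X⟧) 0 := fun a => by
    refine ⟨norm_evalSeries_lt_one hK hw0 (h0 a), ?_⟩
    rw [iterate_evalSeries_comm hK hg0 (h0 a) (intertwines_iff.mp (hi a)) hw0, zero_add,
      Function.iterate_one, evalSeries_polynomial hK hw0, hw.aeval_zero, evalSeries_zero (h0 a)]
  have hfactor : ∀ a, ∃ u : (integers K)⟦X⟧, h a = PowerSeries.X * (PowerSeries.C a +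
      PowerSeries.X * u) := fun a => by
    obtain ⟨D, hD⟩ : PowerSeries.X ^ 2 ∣ h a - PowerSeries.C a * PowerSeries.X := by
      rw [PowerSeries.X_pow_dvd_iff]
      intro m hm
      interval_cases m
      · simp [h0 a]
      · simp [h1 a]
    exact ⟨D, by linear_combination hD⟩
  let φ : integers K ⧸ Ideal.span {π} → torsion Ω (g : (integers K)⟦X⟧) 0 := fun c =>
    ⟨evalSeries (h (Quotient.out c)) (w 0), hmem _⟩
  -- if `[c](w₀) = [d](w₀)`, then `(c - d) w₀` is a multiple of `w₀ ^ 2`, so `c - d` is not a unit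
  have hφ : Function.Injective φ := fun c d hcd => by
    have h2 : evalSeries (h (Quotient.out c)) (w 0) = evalSeries (h (Quotient.out d)) (w 0) :=
      congrArg Subtype.val hcd
    obtain ⟨u, hu⟩ := hfactor (Quotient.out c)
    obtain ⟨v, hv⟩ := hfactor (Quotient.out d)
    rw [hu, hv, evalSeries_mul hK hw0, evalSeries_mul hK hw0, evalSeries_X hK hw0,
      evalSeries_C_add_X_mul hK hw0, evalSeries_C_add_X_mul hK hw0] at h2
    have h3 := mul_left_cancel₀ hw.ne_zero h2
    have h4 : algebraMap K Ω ((Quotient.out c - Quotient.out d : integers K) : K) =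
        w 0 * (evalSeries v (w 0) - evalSeries u (w 0)) := by
      rw [AddSubgroupClass.coe_sub, map_sub]
      linear_combination h3
    have h5 : ‖((Quotient.out c - Quotient.out d : integers K) : K)‖ < 1 := by
      rw [← norm_algebraMap' Ω, h4, norm_mul]
      refine mul_lt_one_of_nonneg_of_lt_one_left (norm_nonneg _) hw0 ?_
      rw [sub_eq_add_neg]
      refine (IsUltrametricDist.norm_add_le_max _ _).trans (max_le ?_ ?_)
      · exact norm_evalSeries_le_one hK hw0 v
      · rw [norm_neg]
        exact norm_evalSeries_le_one hK hw0 u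
    have h6 := uniformizer_dvd hπ h5
    rw [← Ideal.mem_span_singleton, ← Ideal.Quotient.mk_eq_mk_iff_sub_mem] at h6
    rwa [Ideal.Quotient.mk_out, Ideal.Quotient.mk_out] at h6
  have := (finite_torsion_zero (Ω := Ω) hπ hg).to_subtype
  obtain ⟨c, hc⟩ := (hφ.bijective_of_nat_card_le
    (by rw [card_torsion_zero hπ hb hg, hq])).surjective ⟨y, hy⟩
  exact ⟨h (Quotient.out c), h0 _, hi _, (congrArg Subtype.val hc).symm⟩

/-- Every torsion point of level `n` is the value at `wₙ` of a series commuting with `g`. -/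
lemma IsDivisionSequence.exists_evalSeries_eq (hw : IsDivisionSequence g w)
    (hq : q = Nat.card (integers K ⧸ Ideal.span {π})) (n : ℕ) {y : Ω}
    (hy : y ∈ torsion Ω (g : (integers K)⟦X⟧) n) :
    ∃ h : (integers K)⟦X⟧, PowerSeries.constantCoeff h = 0 ∧
      Intertwines (σ := Unit) (g : (integers K)⟦X⟧) g h ∧ y = evalSeries h (w n) := by
  have hK := exists_one_lt_norm hπ
  have hg0 := hg.2.2.constantCoeff_eq
  induction n generalizing y with
  | zero => exact hw.exists_evalSeries_eq_of_mem_torsion_zero hπ hb hg hq hy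
  | succ n ih =>
    have hG := isLubinTateLaw_groupLaw hb hg.2.2
    have hwn := hw.norm_lt_one (n + 1)
    obtain ⟨h, h0, hi, hv⟩ := ih (y := evalSeries (g : (integers K)⟦X⟧) y)
      ⟨norm_evalSeries_lt_one hK hy.1 hg0, by rw [← Function.iterate_succ_apply]; exact hy.2⟩
    have hx := norm_evalSeries_lt_one hK hwn h0
    obtain ⟨z, hz, hyz⟩ := exists_eq_evalLaw_of_aeval_eq hπ hb hg hG hx hy.1 (by
      rw [← evalSeries_polynomial hK hy.1, hv, ← evalSeries_polynomial hK hx,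
        ← evalSeries_subst hK hwn h0, intertwines_iff.mp hi, evalSeries_subst hK hwn hg0,
        evalSeries_polynomial hK hwn, hw.aeval_succ])
    obtain ⟨k, k0, ki, hkz⟩ := hw.exists_evalSeries_eq_of_mem_torsion_zero hπ hb hg hq hz
    obtain ⟨e, e0, ei, hew⟩ := hw.exists_zero_eq hπ hg (n + 1)
    have hke0 := constantCoeff_subst' k0 e0
    -- `y = h(wₙ₊₁) ⊕ k(w₀)`, where `w₀ = e(wₙ₊₁)`
    refine ⟨MvPowerSeries.subst ![h, PowerSeries.subst e k]
      (groupLaw (g : (integers K)⟦X⟧)).toPowerSeries, ?_, ?_, ?_⟩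
    · exact MvPowerSeries.constantCoeff_subst_eq_zero
        (MvPowerSeries.hasSubst_of_constantCoeff_zero (Fin.forall_fin_two.mpr ⟨h0, hke0⟩))
        (Fin.forall_fin_two.mpr ⟨h0, hke0⟩) (FormalGroup.zero_constantCoeff _)
    · exact Intertwines.comp hg0 hg0 (FormalGroup.zero_constantCoeff _) hG.intertwines
        (Fin.forall_fin_two.mpr ⟨h0, hke0⟩)
        (Fin.forall_fin_two.mpr ⟨hi, ki.powerSeries_comp hg0 hg0 k0 e0 ei⟩)
    · rw [evalSeries_subst_law hK hwn _ h0 hke0, evalSeries_subst hK hwn e0, ← hew, ← hkz, hyz]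

open IntermediateField in
/-- The field generated by the torsion points of level `n` is generated by `wₙ` alone. -/
theorem IsDivisionSequence.torsionField_eq_adjoin (hw : IsDivisionSequence g w)
    (hq : q = Nat.card (integers K ⧸ Ideal.span {π})) (n : ℕ) :
    torsionField Ω (g : (integers K)⟦X⟧) n = K⟮w n⟯ := by
  have hK := exists_one_lt_norm hπ
  refine le_antisymm (adjoin_le_iff.mpr fun y hy => ?_)
    (adjoin_simple_le_iff.mpr (subset_adjoin K _ ⟨hw.norm_lt_one n, ?_⟩))
  · obtain ⟨h, -, -, rfl⟩ := hw.exists_evalSeries_eq hπ hb hg hq n hy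
    exact evalSeries_mem hK (hw.norm_lt_one n) (mem_adjoin_simple_self K _) h
  · induction n with
    | zero =>
      rw [zero_add, Function.iterate_one, evalSeries_polynomial hK (hw.norm_lt_one 0),
        hw.aeval_zero]
    | succ n ih =>
      rw [Function.iterate_succ_apply, evalSeries_polynomial hK (hw.norm_lt_one _), hw.aeval_succ,
        ih]

end Generation

section Tower

variable {K : Type*} [NormedField K] [IsUltrametricDist K] {Ω : Type*}
  [NormedField Ω] [NormedAlgebra K Ω] [IsUltrametricDist Ω] [Algebra.IsAlgebraic K Ω]
  {π : integers K} (hπ : Irreducible π) {q : ℕ} (hb : IsFrobeniusBase π q)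
  {g : Polynomial (integers K)} (hg : g ∈ polySet π q) {w : ℕ → Ω}

open IntermediateField Module

omit [IsUltrametricDist Ω] [Algebra.IsAlgebraic K Ω] in
lemma IsDivisionSequence.adjoin_le (hw : IsDivisionSequence g w) (n : ℕ) :
    K⟮w n⟯ ≤ K⟮w (n + 1)⟯ := by
  rw [adjoin_simple_le_iff, ← hw.aeval_succ n, ← Polynomial.aeval_map_algebraMap K]
  exact algebra_adjoin_le_adjoin K _ (Polynomial.aeval_mem_adjoin_singleton K _)

omit [IsUltrametricDist Ω] [Algebra.IsAlgebraic K Ω] in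
include hg in
/-- The polynomial `g(x) - wₙ` over `K(wₙ)`. -/
lemma IsDivisionSequence.exists_polynomial (hb : IsFrobeniusBase π q)
    (hw : IsDivisionSequence g w) (n : ℕ) :
    ∃ P : Polynomial K⟮w n⟯, P.Monic ∧ P.natDegree = q ∧ Polynomial.aeval (w (n + 1)) P = 0 ∧
      P.coeff 0 = -AdjoinSimple.gen K (w n) := by
  have hq := hb.one_lt
  set P₀ : Polynomial K⟮w n⟯ := g.map ((algebraMap K K⟮w n⟯).comp (algebraMap (integers K) K))
    with hP₀
  have hm : P₀.Monic := hg.1.map _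
  have hdeg : P₀.natDegree = q := by rw [hP₀, hg.1.natDegree_map, hg.2.1]
  refine ⟨P₀ - Polynomial.C (AdjoinSimple.gen K (w n)), ?_, ?_, ?_, ?_⟩
  · refine hm.sub_of_left (Polynomial.degree_C_le.trans_lt ?_)
    rw [Polynomial.degree_eq_natDegree hm.ne_zero, hdeg]
    exact_mod_cast zero_lt_one.trans hq
  · rw [Polynomial.natDegree_sub_C, hdeg]
  · rw [map_sub, Polynomial.aeval_C, hP₀, Polynomial.aeval_def, Polynomial.eval₂_map,
      AdjoinSimple.algebraMap_gen, sub_eq_zero]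
    exact hw.aeval_succ n
  · have h0 : g.coeff 0 = 0 := by
      rw [← Polynomial.coeff_coe, PowerSeries.coeff_zero_eq_constantCoeff_apply]
      exact hg.2.2.constantCoeff_eq
    rw [Polynomial.coeff_sub, hP₀, Polynomial.coeff_map, h0, map_zero, Polynomial.coeff_C_zero,
      zero_sub]

omit [NormedField K] [IsUltrametricDist K] [NormedField Ω] [NormedAlgebra K Ω]
  [IsUltrametricDist Ω] [Algebra.IsAlgebraic K Ω] in
lemma extendScalars_eq_adjoin {k E : Type*} [Field k] [Field E] [Algebra k E] {x y : E}
    (h : k⟮x⟯ ≤ k⟮y⟯) : extendScalars h = (k⟮x⟯)⟮y⟯ := by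
  refine le_antisymm ?_ (adjoin_simple_le_iff.mpr (mem_adjoin_simple_self k y))
  rw [extendScalars_le_iff, adjoin_simple_le_iff]
  exact mem_adjoin_simple_self _ y

include hg hπ hb

/-- The degree of the field of division points: it is bounded above by the degrees of the
polynomials `g(x) / x` and `g(x) - wₙ`, and below by the ramification. -/
theorem IsDivisionSequence.finrank_adjoin (hw : IsDivisionSequence g w) (n : ℕ) :
    finrank K K⟮w n⟯ = (q - 1) * q ^ n := by
  have hint : ∀ x : Ω, IsIntegral K x := fun x => Algebra.IsIntegral.isIntegral x
  refine le_antisymm ?_ ?_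
  · induction n with
    | zero =>
      rw [adjoin.finrank (hint _), pow_zero, mul_one]
      have h0 : g.coeff 0 = 0 := by
        rw [← Polynomial.coeff_coe, PowerSeries.coeff_zero_eq_constantCoeff_apply]
        exact hg.2.2.constantCoeff_eq
      have hdiv : Polynomial.X * g.divX = g := by
        conv_rhs => rw [← Polynomial.X_mul_divX_add g, h0, map_zero, add_zero]
      have hmon : (g.divX.map (algebraMap (integers K) K)).Monic :=
        (Polynomial.Monic.of_mul_monic_left Polynomial.monic_X (by rw [hdiv]; exact hg.1)).map _
      have hroot : Polynomial.aeval (w 0) (g.divX.map (algebraMap (integers K) K)) = 0 := by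
        rw [Polynomial.aeval_map_algebraMap]
        refine (mul_eq_zero.mp ?_).resolve_left hw.ne_zero
        have h1 := hw.aeval_zero
        rwa [← hdiv, map_mul, Polynomial.aeval_X] at h1
      refine (Polynomial.natDegree_le_natDegree (minpoly.min K _ hmon hroot)).trans ?_
      refine Polynomial.natDegree_map_le.trans ?_
      rw [Polynomial.natDegree_divX_eq_natDegree_tsub_one, hg.2.1]
    | succ n ih =>
      rw [← finrank_bot_mul_relfinrank (hw.adjoin_le n),
        relfinrank_eq_finrank_of_le (hw.adjoin_le n),
        extendScalars_eq_adjoin, pow_succ, ← mul_assoc]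
      obtain ⟨P, hm, hdeg, hroot, -⟩ := hw.exists_polynomial hg hb n
      refine Nat.mul_le_mul ih ?_
      rw [adjoin.finrank (hint _).tower_top, ← hdeg]
      exact Polynomial.natDegree_le_natDegree (minpoly.min _ _ hm hroot)
  · rw [adjoin.finrank (hint _)]
    by_contra! h
    exact aeval_ne_zero_of_norm_pow_eq hπ (hw.norm_pow_eq hπ hb hg n) (minpoly.ne_zero (hint _)) h
      (minpoly.aeval K _)

/-- The polynomial `g(x) - wₙ` is the minimal polynomial of `wₙ₊₁` over `K(wₙ)`, for reasons of
degree; its constant term gives the norm. -/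
theorem IsDivisionSequence.norm_gen (hw : IsDivisionSequence g w) (n : ℕ) :
    finrank K⟮w n⟯ (K⟮w n⟯)⟮w (n + 1)⟯ = q ∧
      Algebra.norm K⟮w n⟯ (AdjoinSimple.gen K⟮w n⟯ (w (n + 1))) =
        (-1) ^ (q + 1) * AdjoinSimple.gen K (w n) := by
  have hq := hb.one_lt
  have hint : IsIntegral K⟮w n⟯ (w (n + 1)) := (Algebra.IsIntegral.isIntegral (R := K) _).tower_top
  have hfin : finrank K⟮w n⟯ (K⟮w n⟯)⟮w (n + 1)⟯ = q := by
    have h1 := finrank_bot_mul_relfinrank (hw.adjoin_le n)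
    rw [relfinrank_eq_finrank_of_le (hw.adjoin_le n), extendScalars_eq_adjoin,
      hw.finrank_adjoin hπ hb hg, hw.finrank_adjoin hπ hb hg, pow_succ, ← mul_assoc] at h1
    exact Nat.eq_of_mul_eq_mul_left (Nat.mul_pos (by omega) (pow_pos (by omega) _)) h1
  refine ⟨hfin, ?_⟩
  obtain ⟨P, hm, hdeg, hroot, h0⟩ := hw.exists_polynomial hg hb n
  have hdegmin : (minpoly K⟮w n⟯ (w (n + 1))).natDegree = q := by rw [← adjoin.finrank hint, hfin]
  have hP : P = minpoly K⟮w n⟯ (w (n + 1)) :=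
    (Polynomial.eq_of_monic_of_dvd_of_natDegree_le (minpoly.monic hint) hm
      (minpoly.dvd _ _ hroot) (by rw [hdeg, hdegmin]))
  have h2 := Algebra.PowerBasis.norm_gen_eq_coeff_zero_minpoly (adjoin.powerBasis hint)
  rw [adjoin.powerBasis_gen, adjoin.powerBasis_dim, minpoly_gen, ← hP, hdeg, h0] at h2
  rw [h2, pow_succ]
  ring

end Tower

/-! ### Norm compatible sequences -/

section NormCompatible

variable {K : Type*} [NormedField K] [IsUltrametricDist K] [CompleteSpace K] {Ω : Type*}
  [NormedField Ω] [NormedAlgebra K Ω] [IsUltrametricDist Ω] [Algebra.IsAlgebraic K Ω]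
  {π : integers K} (hπ : Irreducible π) {q : ℕ} (hb : IsFrobeniusBase π q)
  {g : Polynomial (integers K)} (hg : g ∈ polySet π q)

open IntermediateField Module

/-- If an invertible series `r` satisfies `h ∘ r = r ∘ f`, then the torsion points of `f` and of `h`
generate the same field: they are values of `r` and of its inverse at one another. -/
lemma torsionField_eq (hK : ∃ x : K, 1 < ‖x‖) {f h r k : (integers K)⟦X⟧}
    (hf : PowerSeries.constantCoeff f = 0)
    (hr : PowerSeries.constantCoeff r = 0) (hk : PowerSeries.constantCoeff k = 0)
    (hrf : PowerSeries.subst r h = PowerSeries.subst f r)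
    (hkr : PowerSeries.subst r k = PowerSeries.X) (hrk : PowerSeries.subst k r = PowerSeries.X)
    (n : ℕ) : torsionField Ω f n = torsionField Ω h n := by
  have hbij := bijOn_torsion (Ω := Ω) hK hf hr hk hrf hkr hrk n
  refine le_antisymm (adjoin_le_iff.mpr fun x hx => ?_) (adjoin_le_iff.mpr fun y hy => ?_)
  · have h1 := evalSeries_mem hK (hbij.mapsTo hx).1 (subset_adjoin K _ (hbij.mapsTo hx)) k
    rwa [← evalSeries_subst hK hx.1 hr, hkr, evalSeries_X hK hx.1] at h1
  · obtain ⟨x, hx, rfl⟩ := hbij.surjOn hy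
    exact evalSeries_mem hK hx.1 (subset_adjoin K _ hx) r

include hπ hb hg

omit [CompleteSpace K] in
/-- The norm of `wₙ₊₁` is `(-1) ^ (q + 1) wₙ`, and the factors `(-1) ^ m` make up for the sign. -/
theorem IsDivisionSequence.isNormCompatible {w : ℕ → Ω} (hw : IsDivisionSequence g w) {m : ℕ}
    (hm : (-1 : Ω) ^ (q + 1) = (-1) ^ m) (hqm : Even (m * q)) {E : ℕ → IntermediateField K Ω}
    (hE : ∀ n, E n = K⟮w n⟯) : IsNormCompatible E (fun n => (-1) ^ m * w n) := by
  obtain rfl : E = fun n => K⟮w n⟯ := funext hE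
  intro n
  obtain ⟨hfin, hnorm⟩ := hw.norm_gen hπ hb hg n
  have hmem : ∀ n, (-1) ^ m * w n ∈ K⟮w n⟯ := fun n =>
    mul_mem (pow_mem (neg_mem (one_mem _)) _) (mem_adjoin_simple_self K _)
  have key : ∀ (L : IntermediateField K⟮w n⟯ Ω), L = (K⟮w n⟯)⟮w (n + 1)⟯ →
      ∀ h : (-1) ^ m * w (n + 1) ∈ L, FiniteDimensional K⟮w n⟯ L ∧
        Algebra.norm K⟮w n⟯ (⟨_, h⟩ : L) = ⟨(-1) ^ m * w n, hmem n⟩ := by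
    rintro L rfl h
    have hint : IsIntegral K⟮w n⟯ (w (n + 1)) :=
      (Algebra.IsIntegral.isIntegral (R := K) _).tower_top
    refine ⟨adjoin.finiteDimensional hint, ?_⟩
    have h1 : (⟨_, h⟩ : (K⟮w n⟯)⟮w (n + 1)⟯) =
        algebraMap K⟮w n⟯ _ ((-1) ^ m) * AdjoinSimple.gen K⟮w n⟯ (w (n + 1)) := by
      apply Subtype.ext
      rw [map_pow, map_neg, map_one]
      rfl
    rw [h1, map_mul, Algebra.norm_algebraMap, hnorm, hfin, ← pow_mul, hqm.neg_one_pow, one_mul]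
    apply Subtype.ext
    show (-1 : Ω) ^ (q + 1) * w n = _
    rw [hm]
  exact ⟨hw.adjoin_le n, hmem n, hmem (n + 1),
    key _ (extendScalars_eq_adjoin (hw.adjoin_le n)) (hmem (n + 1))⟩

variable [IsAlgClosed Ω]

/-- The values of `r` at division points of `f` are division points of `g`, and they generate the
fields generated by the torsion points of `f`. -/
theorem isNormCompatible_evalSeries (hq : q = Nat.card (integers K ⧸ Ideal.span {π}))
    {m : ℕ} (hm : (-1 : Ω) ^ (q + 1) = (-1) ^ m) (hqm : Even (m * q))
    {f r : (integers K)⟦X⟧} {F G : FormalGroup (integers K)}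
    (hf : PowerSeries.constantCoeff f = 0) (hr : IsFormalIso F G r)
    (hrf : PowerSeries.subst r (g : (integers K)⟦X⟧) = PowerSeries.subst f r) {v : ℕ → Ω}
    (hv : ∀ n, v n ∈ torsion Ω f n) (hv0 : v 0 ≠ 0) (hvs : ∀ n, evalSeries f (v (n + 1)) = v n) :
    IsNormCompatible (fun n => torsionField Ω f n) (fun n => (-1) ^ m * evalSeries r (v n)) := by
  have hK := exists_one_lt_norm hπ
  obtain ⟨hrh, k, hkh, hkr, hrk⟩ := hr
  have hbij := bijOn_torsion (Ω := Ω) hK hf hrh.1 hkh.1 hrf hkr hrk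
  have hw : IsDivisionSequence g (fun n => evalSeries r (v n)) :=
    { norm_lt_one := fun n => ((hbij n).mapsTo (hv n)).1
      ne_zero := fun h0 => hv0 ((hbij 0).injOn (hv 0)
        ⟨by rw [norm_zero]; exact zero_lt_one, by
          rw [zero_add, Function.iterate_one, evalSeries_zero hf]⟩
        (h0.trans (evalSeries_zero hrh.1).symm))
      aeval_zero := (torsion_zero_eq hπ hg).subset ((hbij 0).mapsTo (hv 0))
      aeval_succ := fun n => by
        rw [← evalSeries_polynomial hK ((hbij _).mapsTo (hv (n + 1))).1]
        have h1 := iterate_evalSeries_comm hK hf hrh.1 hrf (hv (n + 1)).1 1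
        rwa [Function.iterate_one, Function.iterate_one, hvs] at h1 }
  exact hw.isNormCompatible hπ hb hg hm hqm fun n =>
    (torsionField_eq hK hf hrh.1 hkh.1 hrf hkr hrk n).trans
      (hw.torsionField_eq_adjoin hπ hb hg hq n)

end NormCompatible

end LubinTate

end

theorem proposition4p2 {p : ℕ} [Fact p.Prime]
    {K : Type*} [NormedField K] [IsUltrametricDist K] [NormedAlgebra ℚ_[p] K]
    [FiniteDimensional ℚ_[p] K]
    {Ω : Type*} [NormedField Ω] [NormedAlgebra K Ω] [IsAlgClosure K Ω]
    (π : LubinTate.integers K) (hπ : Irreducible π)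
    (q : ℕ) (hq : q = Nat.card (LubinTate.integers K ⧸ Ideal.span {π}))
    (f : (LubinTate.integers K)⟦X⟧) (hf : LubinTate.IsFrobeniusSeries π q f)
    (g : Polynomial (LubinTate.integers K)) (hg : g ∈ LubinTate.polySet π q) :
    -- the formal group laws `F_f`, `F_g` and the isomorphism `r = i_{f,g}` are well defined
    (∃! F, LubinTate.IsLubinTateLaw f F) ∧
    (∃! G, LubinTate.IsLubinTateLaw (g : (LubinTate.integers K)⟦X⟧) G) ∧
    (∃! r, LubinTate.IsTangentIso (LubinTate.groupLaw f)
      (LubinTate.groupLaw (g : (LubinTate.integers K)⟦X⟧)) r) ∧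
    -- the sets of torsion points of level `0` are finite
    (LubinTate.torsion Ω f 0).Finite ∧
    (LubinTate.torsion Ω (g : (LubinTate.integers K)⟦X⟧) 0).Finite ∧
    -- the product formula for `s(x) ⊕_g z`
    (∀ s : (LubinTate.integers K)⟦X⟧, PowerSeries.constantCoeff s = 0 →
      ∏ᶠ z ∈ LubinTate.torsion Ω (g : (LubinTate.integers K)⟦X⟧) 0,
          LubinTate.evalLaw (LubinTate.groupLaw (g : (LubinTate.integers K)⟦X⟧))
            (LubinTate.toSeries Ω s) (PowerSeries.C z : Ω⟦X⟧) =
        (-1) ^ (p - 1) * LubinTate.toSeries Ω (Polynomial.aeval s g)) ∧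
    -- the product formula for `r(x ⊕_f v)`
    (∏ᶠ v ∈ LubinTate.torsion Ω f 0,
        LubinTate.evalSeries (LubinTate.tangentIso f (g : (LubinTate.integers K)⟦X⟧))
          (LubinTate.evalLaw (LubinTate.groupLaw f) (PowerSeries.X : Ω⟦X⟧) (PowerSeries.C v)) =
      (-1) ^ (p - 1) * LubinTate.toSeries Ω
        (PowerSeries.subst f (LubinTate.tangentIso f (g : (LubinTate.integers K)⟦X⟧)))) ∧
    -- the norm compatible sequences
    (∀ v : ℕ → Ω, (∀ n, v n ∈ LubinTate.torsion Ω f n) → v 0 ≠ 0 →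
      (∀ n, LubinTate.evalSeries f (v (n + 1)) = v n) →
      LubinTate.IsNormCompatible (fun n => LubinTate.torsionField Ω f n)
        (fun n => (-1) ^ (p - 1) *
          LubinTate.evalSeries (LubinTate.tangentIso f (g : (LubinTate.integers K)⟦X⟧)) (v n))) := by
  have hpK : ‖(p : K)‖ < 1 := by
    rw [← map_natCast (algebraMap ℚ_[p] K) p, norm_algebraMap']
    exact Padic.norm_p_lt_one
  have : CompleteSpace K := FiniteDimensional.complete ℚ_[p] K
  have : CharZero K := charZero_of_injective_algebraMap (algebraMap ℚ_[p] K).injective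
  have : IsAlgClosed Ω := IsAlgClosure.isAlgClosed K
  have : Algebra.IsAlgebraic K Ω := IsAlgClosure.isAlgebraic
  -- the absolute value of `Ω` is nonarchimedean since it is bounded on the integers
  have : IsUltrametricDist Ω :=
    IsUltrametricDist.isUltrametricDist_of_forall_norm_natCast_le_one fun n => by
      rw [← map_natCast (algebraMap K Ω) n, norm_algebraMap']
      exact IsUltrametricDist.norm_natCast_le_one K n
  obtain ⟨hb, m, hm, hqm⟩ := LubinTate.isFrobeniusBase hπ hpK hq hf
  have hsign : ∀ {B : Type _} [CommRing B], (-1 : B) ^ (q + 1) = (-1) ^ (p - 1) := fun {B} _ => by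
    rw [hqm]
    exact LubinTate.neg_one_pow_prime_pow_succ Fact.out hm
  have hF := LubinTate.isLubinTateLaw_groupLaw hb hf
  have hG := LubinTate.isLubinTateLaw_groupLaw hb hg.2.2
  obtain ⟨hr, hrf⟩ := LubinTate.isTangentIso_tangentIso hb hf hg.2.2
  have hK := LubinTate.exists_one_lt_norm hπ
  have hf0 := hf.constantCoeff_eq
  have hfin := LubinTate.finite_torsion_zero (Ω := Ω) hπ hg
  refine ⟨LubinTate.existsUnique_isLubinTateLaw hb hf,
    LubinTate.existsUnique_isLubinTateLaw hb hg.2.2,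
    LubinTate.existsUnique_isTangentIso hb hf hg.2.2 hF hG, ?_, hfin, fun s hs => ?_, ?_,
    fun v hv hv0 hvs => ?_⟩
  · obtain ⟨hrh, k, hkh, hkr, hrk⟩ := hr.1
    exact (LubinTate.bijOn_torsion hK hf0 hrh.1 hkh.1 hrf hkr hrk 0).finite_iff_finite.mpr hfin
  · rw [LubinTate.finprod_evalLaw_toSeries hπ hb hg hG hs, hsign]
  · rw [LubinTate.finprod_evalSeries_evalLaw hπ hb hg hG hf0 hr.1 hrf, hsign]
  · refine LubinTate.isNormCompatible_evalSeries hπ hb hg hq hsign ?_ hf0 hr.1 hrf hv hv0 hvs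
    -- `(p - 1) q` is even, so the sign `(-1) ^ (p - 1)` has norm `1` in an extension of degree `q`
    rcases (Fact.out : p.Prime).eq_two_or_odd' with rfl | ho
    · rw [hqm]
      exact (even_two.pow_of_ne_zero hm).mul_left _
    · exact (Nat.Odd.sub_odd ho odd_one).mul_right _
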